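/- For $\eta\in\mathbb R$ consider the self-adjoint operators $L_{\mathsf D}(\eta)$ and $L_{\mathsf N}(\eta)$ in $L^2(\mathbb R^-)$, $\mathbb R^-=(-\infty,0)$, given by $$L(\eta)=-\partial_x^2+(x+\eta)^2$$ with the Dirichlet condition $u(0)=0$ and the Neumann condition $u'(0)=0$ respectively; their domains consist of the $u\in L^2(\mathbb R^-)$ such that $u,u'$ are locally absolutely continuous on $(-\infty,0]$, $-u''+(x+\eta)^2u\in L^2(\mathbb R^-)$, and the boundary condition holds. For each $\eta$, the eigenvalues of each operator are simple and form an infinite sequence that can be listed in increasing order; let $$\lambda_{\mathsf D,0}(\eta)<\lambda_{\mathsf D,1}(\eta)<\cdots,\qquad \lambda_{\mathsf N,0}(\eta)<\lambda_{\mathsf N,1}(\eta)<\cdots$$ be the lists of all eigenvalues of $L_{\mathsf D}(\eta)$ and of $L_{\mathsf N}(\eta)$. Then for every $n=0,1,2,\dots$ the functions $\lambda_{\mathsf D,n}$ and $\lambda_{\mathsf N,n}$ are real analytic on $\mathbb R$, and: (i) $\lambda_{\mathsf D,n}$ is strictly decreasing on $\mathbb R$; $\lambda_{\mathsf D,n}(\eta)\to+\infty$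 as $\eta\to-\infty$; $\lambda_{\mathsf D,n}(\eta)\to 2n+1$ as $\eta\to+\infty$; $\lambda_{\mathsf D,n}(0)=4n+3$. (ii) $\lambda_{\mathsf N,n}$ is strictly decreasing on $(-\infty,0]$; $\lambda_{\mathsf N,n}(\eta)\to+\infty$ as $\eta\to-\infty$; $\lambda_{\mathsf N,n}(\eta)<2n+1$ for all $\eta\ge(2n+1)^{1/2}$; $\lambda_{\mathsf N,n}(0)=4n+1$. (iii) For all $\eta\in\mathbb R$: $\lambda_{\mathsf N,n}(\eta)<\lambda_{\mathsf D,n}(\eta)<\lambda_{\mathsf N,n+1}(\eta)$, $\lambda_{\mathsf D,n}(\eta)>2n+1$ and $\lambda_{\mathsf N,n}(\eta)>(2n-1)_+$, where $t_+=\max(t,0)$. -/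

import Mathlib

open MeasureTheory Set Filter Topology

/-- The Hilbert space `L²(ℝ⁻)` of real square-integrable functions on the half-line `x < 0`. -/
abbrev L2NegHalfLine : Type := Lp ℝ 2 (volume.restrict (Iio (0 : ℝ)))

/-- The two boundary conditions at the endpoint `x = 0` of the half-line. -/
inductive BoundaryCondition where
  | dirichlet
  | neumann

/-- The boundary condition, for a function with value `u₀` and derivative `v₀` at `x = 0`:
`u₀ = 0` for Dirichlet, `v₀ = 0` for Neumann. -/
def BoundaryCondition.Holds : BoundaryCondition → ℝ → ℝ → Prop
  | .dirichlet, u₀, _ => u₀ = 0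
  | .neumann, _, v₀ => v₀ = 0

/-- The graph of the self-adjoint operator `L(η) = -∂ₓ² + (x + η)²` in `L²(ℝ⁻)` with boundary
condition `bc` at `x = 0`: `f` belongs to the domain of the operator and `L(η) f = g`.
The domain consists of the `f ∈ L²(ℝ⁻)` which have a representative `u` on `(-∞, 0]` such that
`u` and `v = u'` are locally absolutely continuous, `-u'' + (x + η)² u` is in `L²(ℝ⁻)`, and `u`
satisfies the boundary condition. The two integral identities say that `u` is locally absolutely
continuous with derivative `v`, and that `v` is locally absolutely continuous with derivative
`(x + η)² u - g`. (Since `u` and `g` are square-integrable on bounded intervals, all the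
integrands are integrable on `[x, 0]`.) -/
def IsOscillatorGraph (bc : BoundaryCondition) (η : ℝ) (f g : L2NegHalfLine) : Prop :=
  ∃ u v : ℝ → ℝ,
    f =ᵐ[volume.restrict (Iio (0 : ℝ))] u ∧
    (∀ x ≤ 0, u x = u 0 - ∫ t in x..0, v t) ∧
    (∀ x ≤ 0, v x = v 0 - ∫ t in x..0, ((t + η) ^ 2 * u t - g t)) ∧
    bc.Holds (u 0) (v 0)

/-- `f` is an eigenfunction of the operator `L(η)` with boundary condition `bc`, with
eigenvalue `μ`. -/
def IsOscillatorEigenfunction (bc : BoundaryCondition) (η μ : ℝ) (f : L2NegHalfLine) : Prop :=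
  f ≠ 0 ∧ IsOscillatorGraph bc η f (μ • f)

/-- The set of eigenvalues of the operator `L(η)` with boundary condition `bc`. -/
def oscillatorEigenvalues (bc : BoundaryCondition) (η : ℝ) : Set ℝ :=
  {μ | ∃ f, IsOscillatorEigenfunction bc η μ f}

/-- `l 0 < l 1 < l 2 < ⋯` is the list of all the eigenvalues of the operator `L(η)` with boundary
condition `bc`, and each of them is simple (so that the list is also the list of the eigenvalues
repeated according to their multiplicity). There is at most one such sequence `l`, because a
strictly increasing sequence is determined by its range. -/
structure IsOscillatorEigenvalueSequence (bc : BoundaryCondition) (η : ℝ) (l : ℕ → ℝ) : Prop where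
  strictMono : StrictMono l
  range_eq : range l = oscillatorEigenvalues bc η
  simple : ∀ n, ∀ f g : L2NegHalfLine, IsOscillatorEigenfunction bc η (l n) f →
    IsOscillatorEigenfunction bc η (l n) g → ∃ c : ℝ, g = c • f

/-! Under `y = -η - x` the eigenvalue equation with eigenvalue `2ν + 1` becomes `u'' = (y² - (2ν +
1)) u`, the half-line becomes `y > -η`, and the boundary point becomes `y = -η`. For every real `ν`
this equation has one decaying solution up to scaling, `u_ν(y) = exp(-y²/2) H_ν(y)`, where `H_ν` is
the Hermite function of degree `ν`. It is built from a Mellin transform for `Re ν < 0` and continued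
by the three-term recurrence, which makes it holomorphic in the degree and in the argument. By a
Wronskian argument (`eq_const_mul_oscSol`) every square-integrable solution is a multiple of `u_ν`.
So `2ν + 1` is a Dirichlet or Neumann eigenvalue exactly when `u_ν(-η) = 0` or `u_ν'(-η) = 0`.

To count these `ν`, follow the polar angle `θ(ν, y)` of `(u_ν, u_ν')` as `ν` varies. Its
`ν`-derivative is a Wronskian divided by `u_ν² + u_ν'²`, and this Wronskian decreases in `y` to `0`,
hence is positive (`oscWronskian_pos`). The angle thus increases strictly in `ν`, from a value in
`(-π/2, 0)` at `ν = -1`, without bound. The levels `π/2 + nπ` give the Dirichlet degrees and `nπ`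
the Neumann degrees, so listing, simplicity and interlacing come together.

The rest concerns these level curves as functions of `y`. Analyticity and monotonicity come from the
implicit function theorem, with the Wronskian supplying nonvanishing and sign. The growth as `y →
+∞` holds because `u_ν u_ν' < 0` where the potential exceeds the energy. The bound `ν > n` on the
Dirichlet curve counts zeros of the Hermite polynomial of degree `n` (`lt_dirichletDeg`). The limit
`n` at `-∞` uses the sign of `H_ν` there (`tendsto_dirichletDeg_atBot`), and the Neumann upper bound
uses the parity of Hermite polynomials (`neumannDeg_lt`). -/

/-! ### The Mellin transform of a shifted Gaussian -/

/-- The Mellin transform of `t ↦ exp (-t² - 2ty)`. -/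
noncomputable def gaussMellin (a y : ℂ) : ℂ :=
  mellin (fun t : ℝ => Complex.exp (-(t : ℂ) ^ 2 - 2 * t * y)) a

lemma norm_gauss_exp (y : ℂ) (t : ℝ) :
    ‖Complex.exp (-(t : ℂ) ^ 2 - 2 * t * y)‖ = Real.exp (-t ^ 2 - 2 * t * y.re) := by
  rw [Complex.norm_exp]
  congr 1
  have : (-(t : ℂ) ^ 2 - 2 * t * y) = ((-t ^ 2 : ℝ) : ℂ) - ((2 * t : ℝ) : ℂ) * y := by
    push_cast; ring
  rw [this, Complex.sub_re, Complex.ofReal_re, Complex.re_ofReal_mul]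

lemma gauss_exp_isBigO_atTop (y : ℂ) :
    (fun t : ℝ => Complex.exp (-(t : ℂ) ^ 2 - 2 * t * y)) =O[atTop]
      fun t : ℝ => Real.exp (-1 * t) := by
  apply Asymptotics.IsBigO.of_bound 1
  filter_upwards [eventually_ge_atTop (max 0 (1 - 2 * y.re))] with t ht
  rw [norm_gauss_exp, Real.norm_eq_abs, Real.abs_exp, one_mul]
  apply Real.exp_le_exp.2
  have h0 := le_trans (le_max_left _ _) ht
  have h1 := le_trans (le_max_right _ _) ht
  nlinarith

lemma gauss_exp_isBigO_zero (y : ℂ) :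
    (fun t : ℝ => Complex.exp (-(t : ℂ) ^ 2 - 2 * t * y)) =O[𝓝[>] 0]
      fun t : ℝ => t ^ (-(0 : ℝ)) := by
  have : Continuous (fun t : ℝ => Complex.exp (-(t : ℂ) ^ 2 - 2 * t * y)) := by fun_prop
  simp only [neg_zero, Real.rpow_zero]
  exact ((this.tendsto 0).mono_left nhdsWithin_le_nhds).isBigO_one ℝ

lemma gauss_exp_locallyIntegrableOn (y : ℂ) :
    LocallyIntegrableOn (fun t : ℝ => Complex.exp (-(t : ℂ) ^ 2 - 2 * t * y)) (Ioi 0) := by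
  have : Continuous (fun t : ℝ => Complex.exp (-(t : ℂ) ^ 2 - 2 * t * y)) := by fun_prop
  exact this.locallyIntegrable.locallyIntegrableOn _

lemma gaussMellin_convergent {a : ℂ} (ha : 0 < a.re) (y : ℂ) :
    MellinConvergent (fun t : ℝ => Complex.exp (-(t : ℂ) ^ 2 - 2 * t * y)) a :=
  mellinConvergent_of_isBigO_rpow_exp one_pos (gauss_exp_locallyIntegrableOn y)
    (gauss_exp_isBigO_atTop y) (gauss_exp_isBigO_zero y) ha

lemma gaussMellin_integrable {a : ℂ} (ha : 0 < a.re) (y : ℂ) :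
    Integrable (fun t : ℝ => (t : ℂ) ^ (a - 1) * Complex.exp (-(t : ℂ) ^ 2 - 2 * t * y))
      (volume.restrict (Ioi 0)) :=
  gaussMellin_convergent ha y

lemma differentiableAt_gaussMellin {a : ℂ} (ha : 0 < a.re) (y : ℂ) :
    DifferentiableAt ℂ (fun a => gaussMellin a y) a :=
  mellin_differentiableAt_of_isBigO_rpow_exp one_pos (gauss_exp_locallyIntegrableOn y)
    (gauss_exp_isBigO_atTop y) (gauss_exp_isBigO_zero y) ha

lemma norm_gaussMellin_integrand {t : ℝ} (ht : 0 < t) (a y : ℂ) :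
    ‖(t : ℂ) ^ (a - 1) • Complex.exp (-(t : ℂ) ^ 2 - 2 * t * y)‖ =
      t ^ (a.re - 1) * Real.exp (-t ^ 2 - 2 * t * y.re) := by
  rw [norm_smul, norm_gauss_exp, Complex.norm_cpow_eq_rpow_re_of_pos ht, Complex.sub_re,
    Complex.one_re]

lemma integrable_gauss_rpow {a : ℝ} (ha : 0 < a) (y : ℝ) :
    IntegrableOn (fun t : ℝ => t ^ (a - 1) * Real.exp (-t ^ 2 - 2 * t * y)) (Ioi 0) := by
  have := (gaussMellin_convergent (a := a) (by simpa using ha) y).norm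
  refine IntegrableOn.congr_fun this (fun t ht => ?_) measurableSet_Ioi
  simpa using norm_gaussMellin_integrand ht (a : ℂ) y

lemma aestronglyMeasurable_gauss_cpow (a y : ℂ) :
    AEStronglyMeasurable (fun t : ℝ => (t : ℂ) ^ (a - 1) • Complex.exp (-(t : ℂ) ^ 2 - 2 * t * y))
      (volume.restrict (Ioi 0)) := by
  refine ContinuousOn.aestronglyMeasurable (fun t ht => ?_) measurableSet_Ioi
  refine ContinuousAt.continuousWithinAt ?_
  have h : ContinuousAt (fun t : ℝ => Complex.exp (-(t : ℂ) ^ 2 - 2 * t * y)) t := by fun_prop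
  exact (Complex.continuousAt_ofReal_cpow_const _ _ (Or.inr (ne_of_gt ht))).smul h

lemma rpow_le_add_rpow {t b c d : ℝ} (ht : 0 < t) (hc : c ≤ b) (hd : b ≤ d) :
    t ^ b ≤ t ^ c + t ^ d := by
  rcases le_total 1 t with h | h
  · exact le_add_of_nonneg_of_le (Real.rpow_nonneg ht.le _) (Real.rpow_le_rpow_of_exponent_le h hd)
  · exact le_add_of_le_of_nonneg (Real.rpow_le_rpow_of_exponent_ge ht h hc)
      (Real.rpow_nonneg ht.le _)

lemma continuousAt_gaussMellin {a : ℂ} (ha : 0 < a.re) (y : ℂ) :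
    ContinuousAt (fun p : ℂ × ℂ => gaussMellin p.1 p.2) (a, y) := by
  have hc : 0 < a.re / 2 := by positivity
  unfold gaussMellin mellin
  -- For parameters near `(a, y)` the exponent lies between `a.re / 2` and `a.re + 1`; the two
  -- powers dominate for small and for large `t`, and `y.re - 1` is a lower bound for the nearby
  -- real parts.
  refine continuousAt_of_dominated (bound := fun t : ℝ =>
    t ^ (a.re / 2 - 1) * Real.exp (-t ^ 2 - 2 * t * (y.re - 1)) +
    t ^ (a.re + 1 - 1) * Real.exp (-t ^ 2 - 2 * t * (y.re - 1))) ?_ ?_ ?_ ?_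
  · exact Eventually.of_forall fun p => aestronglyMeasurable_gauss_cpow p.1 p.2
  · have h1 : ∀ᶠ p : ℂ × ℂ in 𝓝 (a, y), a.re / 2 < p.1.re :=
      (Complex.continuous_re.comp continuous_fst).continuousAt.eventually_const_lt
        (by simpa using half_lt_self ha)
    have h2 : ∀ᶠ p : ℂ × ℂ in 𝓝 (a, y), p.1.re < a.re + 1 :=
      (Complex.continuous_re.comp continuous_fst).continuousAt.eventually_lt_const (by simp)
    have h3 : ∀ᶠ p : ℂ × ℂ in 𝓝 (a, y), y.re - 1 < p.2.re :=
      (Complex.continuous_re.comp continuous_snd).continuousAt.eventually_const_lt (by simp)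
    filter_upwards [h1, h2, h3] with p h1 h2 h3
    refine (ae_restrict_iff' measurableSet_Ioi).2 (Eventually.of_forall fun t ht => ?_)
    have ht : 0 < t := ht
    rw [norm_gaussMellin_integrand ht, ← add_mul]
    gcongr
    exact rpow_le_add_rpow ht (by linarith) (by linarith)
  · exact (integrable_gauss_rpow hc _).add (integrable_gauss_rpow (by linarith) _)
  · refine (ae_restrict_iff' measurableSet_Ioi).2 (Eventually.of_forall fun t ht => ?_)
    have ht : (t : ℂ) ≠ 0 := by exact_mod_cast ne_of_gt ht
    have h : ContinuousAt (fun p : ℂ × ℂ => Complex.exp (-(t : ℂ) ^ 2 - 2 * t * p.2)) (a, y) := by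
      fun_prop
    have h' : ContinuousAt (fun p : ℂ × ℂ => p.1 - 1) (a, y) := by fun_prop
    exact (h'.const_cpow (Or.inl ht)).smul h

lemma hasDerivAt_gaussMellin {a : ℂ} (ha : 0 < a.re) (y : ℂ) :
    HasDerivAt (gaussMellin a) (-2 * gaussMellin (a + 1) y) y := by
  have key := hasDerivAt_integral_of_dominated_loc_of_deriv_le (μ := volume.restrict (Ioi (0 : ℝ)))
    (𝕜 := ℂ) (E := ℂ)
    (F := fun (y : ℂ) (t : ℝ) => (t : ℂ) ^ (a - 1) • Complex.exp (-(t : ℂ) ^ 2 - 2 * t * y))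
    (F' := fun (y : ℂ) (t : ℝ) =>
      (-2 : ℂ) * ((t : ℂ) ^ (a + 1 - 1) • Complex.exp (-(t : ℂ) ^ 2 - 2 * t * y)))
    (bound := fun t : ℝ => 2 * (t ^ ((a + 1).re - 1) * Real.exp (-t ^ 2 - 2 * t * (y.re - 1))))
    (s := Metric.ball y 1) (x₀ := y) (Metric.ball_mem_nhds y one_pos)
    (Eventually.of_forall fun z => aestronglyMeasurable_gauss_cpow a z)
    (gaussMellin_convergent ha y) ((aestronglyMeasurable_gauss_cpow (a + 1) y).const_mul _)
    ?_ ((integrable_gauss_rpow (by simp; linarith) _).const_mul _) ?_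
  · have := key.2
    rw [integral_const_mul] at this
    exact this
  · refine (ae_restrict_iff' measurableSet_Ioi).2 (Eventually.of_forall fun t ht z hz => ?_)
    have ht : 0 < t := ht
    rw [norm_mul, norm_gaussMellin_integrand ht]
    have : y.re - 1 < z.re := by
      have h := (Complex.abs_re_le_norm (z - y)).trans_lt (by simpa [dist_eq_norm] using hz)
      have := (abs_lt.1 h).1
      rw [Complex.sub_re] at this
      linarith
    simp only [norm_neg, Complex.norm_ofNat]
    gcongr
  · refine (ae_restrict_iff' measurableSet_Ioi).2 (Eventually.of_forall fun t ht z hz => ?_)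
    have ht : (t : ℂ) ≠ 0 := by exact_mod_cast ne_of_gt ht
    have h1 : HasDerivAt (fun z : ℂ => -(t : ℂ) ^ 2 - 2 * t * z) (-(2 * (t : ℂ))) z := by
      simpa using ((hasDerivAt_id' z).const_mul (2 * (t : ℂ))).const_sub (-(t : ℂ) ^ 2)
    refine (h1.cexp.const_mul ((t : ℂ) ^ (a - 1))).congr_deriv ?_
    rw [show a + 1 - 1 = a - 1 + 1 by ring, Complex.cpow_add _ _ ht, Complex.cpow_one]
    simp only [smul_eq_mul]
    ring

lemma gauss_cpow_tendsto_zero (a y : ℂ) :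
    Tendsto (fun t : ℝ => (t : ℂ) ^ a * Complex.exp (-(t : ℂ) ^ 2 - 2 * t * y)) atTop (𝓝 0) := by
  have h1 : (fun t : ℝ => (t : ℂ) ^ a) =O[atTop] fun t : ℝ => t ^ a.re := by
    apply Asymptotics.IsBigO.of_bound 1
    filter_upwards [eventually_gt_atTop 0] with t ht
    rw [Complex.norm_cpow_eq_rpow_re_of_pos ht, one_mul]
    exact le_abs_self _
  refine (h1.mul (gauss_exp_isBigO_atTop y)).trans_tendsto ?_
  exact tendsto_rpow_mul_exp_neg_mul_atTop_nhds_zero a.re 1 one_pos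

lemma hasDerivAt_cpow_mul_gauss (a y : ℂ) {t : ℝ} (ht : 0 < t) :
    HasDerivAt (fun t : ℝ => (t : ℂ) ^ a * Complex.exp (-(t : ℂ) ^ 2 - 2 * t * y))
      (a * ((t : ℂ) ^ (a - 1) * Complex.exp (-(t : ℂ) ^ 2 - 2 * t * y))
        - 2 * y * ((t : ℂ) ^ (a + 1 - 1) * Complex.exp (-(t : ℂ) ^ 2 - 2 * t * y))
        - 2 * ((t : ℂ) ^ (a + 2 - 1) * Complex.exp (-(t : ℂ) ^ 2 - 2 * t * y))) t := by
  have ht' : (t : ℂ) ≠ 0 := by exact_mod_cast ne_of_gt ht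
  have h0 : HasDerivAt (fun t : ℝ => (t : ℂ)) 1 t := Complex.ofRealCLM.hasDerivAt
  have h1 : HasDerivAt (fun z : ℂ => z ^ a) (a * (t : ℂ) ^ (a - 1)) (t : ℂ) := by
    simpa using (hasDerivAt_id (t : ℂ)).cpow_const (c := a)
      (Or.inl (by simpa using ht))
  have h2 : HasDerivAt (fun z : ℂ => -z ^ 2 - 2 * z * y) (-(2 * (t : ℂ)) - 2 * y) (t : ℂ) := by
    have := ((hasDerivAt_id' (t : ℂ)).fun_pow 2).fun_neg.fun_sub
      (((hasDerivAt_id' (t : ℂ)).const_mul 2).mul_const y)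
    simpa using this
  refine ((h1.mul h2.cexp).comp_ofReal).congr_deriv ?_
  rw [show a + 2 - 1 = a + 1 by ring, show a + 1 - 1 = a by ring, Complex.cpow_add _ _ ht',
    Complex.cpow_one]
  ring

/-- Integrate the derivative of `t ^ a * exp (-t² - 2ty)` over `(0, ∞)`: both boundary terms vanish
because `0 < a.re`. -/
lemma gaussMellin_recurrence {a : ℂ} (ha : 0 < a.re) (y : ℂ) :
    a * gaussMellin a y = 2 * y * gaussMellin (a + 1) y + 2 * gaussMellin (a + 2) y := by
  have c0 := gaussMellin_integrable ha y
  have c1 := gaussMellin_integrable (a := a + 1) (by simp; linarith) y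
  have c2 := gaussMellin_integrable (a := a + 2) (by simp; linarith) y
  have hcont : ContinuousWithinAt
      (fun t : ℝ => (t : ℂ) ^ a * Complex.exp (-(t : ℂ) ^ 2 - 2 * t * y)) (Ici 0) 0 := by
    refine ContinuousAt.continuousWithinAt (ContinuousAt.mul ?_ (by fun_prop))
    exact Complex.continuousAt_ofReal_cpow_const _ _ (Or.inl ha)
  have ha0 : a ≠ 0 := by rintro rfl; simp at ha
  have key := integral_Ioi_of_hasDerivAt_of_tendsto hcont
    (fun t ht => hasDerivAt_cpow_mul_gauss a y ht)
    (((c0.const_mul a).sub (c1.const_mul (2 * y))).sub (c2.const_mul 2))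
    (gauss_cpow_tendsto_zero a y)
  rw [integral_sub (f := fun t : ℝ => a * _ - 2 * y * _)
      ((c0.const_mul a).sub (c1.const_mul (2 * y))) (c2.const_mul 2),
    integral_sub (c0.const_mul a) (c1.const_mul (2 * y)), integral_const_mul,
    integral_const_mul, integral_const_mul] at key
  simp only [Complex.ofReal_zero, Complex.zero_cpow ha0, zero_mul, sub_zero] at key
  have e : ∀ b, ∫ t : ℝ in Ioi 0, (t : ℂ) ^ (b - 1) * Complex.exp (-(t : ℂ) ^ 2 - 2 * t * y) =
    gaussMellin b y := fun b => rfl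
  rw [e, e, e] at key
  linear_combination key

/-- The same integration at `a = 0`, where the boundary term at `0` survives and contributes `1`. It
is what gives `H_0 = 1`. -/
lemma gaussMellin_one_two (y : ℂ) : 2 * y * gaussMellin 1 y + 2 * gaussMellin 2 y = 1 := by
  have c1 := gaussMellin_integrable (a := 1) (by simp) y
  have c2 := gaussMellin_integrable (a := 2) (by simp) y
  have key := integral_Ioi_of_hasDerivAt_of_tendsto (a := 0)
    (f := fun t : ℝ => (t : ℂ) ^ (0 : ℂ) * Complex.exp (-(t : ℂ) ^ 2 - 2 * t * y))
    (f' := fun t : ℝ => -(2 * y * ((t : ℂ) ^ ((1 : ℂ) - 1) *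
        Complex.exp (-(t : ℂ) ^ 2 - 2 * t * y))
        + 2 * ((t : ℂ) ^ ((2 : ℂ) - 1) * Complex.exp (-(t : ℂ) ^ 2 - 2 * t * y))))
    (by simp only [Complex.cpow_zero]; fun_prop)
    (fun t ht => (hasDerivAt_cpow_mul_gauss 0 y ht).congr_deriv (by ring_nf))
    ((c1.const_mul (2 * y)).add (c2.const_mul 2)).neg
    (gauss_cpow_tendsto_zero 0 y)
  rw [integral_neg, integral_add (c1.const_mul (2 * y)) (c2.const_mul 2),
    integral_const_mul, integral_const_mul] at key
  have e : ∀ b, ∫ t : ℝ in Ioi 0, (t : ℂ) ^ (b - 1) * Complex.exp (-(t : ℂ) ^ 2 - 2 * t * y) =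
    gaussMellin b y := fun b => rfl
  rw [e, e] at key
  simp at key
  linear_combination -key

lemma gaussMellin_ofReal (a y : ℝ) :
    gaussMellin a y =
      ((∫ t : ℝ in Ioi 0, t ^ (a - 1) * Real.exp (-t ^ 2 - 2 * t * y) : ℝ) : ℂ) := by
  rw [← integral_complex_ofReal]
  refine setIntegral_congr_fun measurableSet_Ioi fun t ht => ?_
  simp only [smul_eq_mul, Complex.ofReal_mul, Complex.ofReal_exp]
  rw [Complex.ofReal_cpow (le_of_lt ht)]
  push_cast
  rfl

lemma gauss_rpow_integral_pos {a : ℝ} (ha : 0 < a) (y : ℝ) :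
    0 < ∫ t : ℝ in Ioi 0, t ^ (a - 1) * Real.exp (-t ^ 2 - 2 * t * y) := by
  rw [setIntegral_pos_iff_support_of_nonneg_ae _ (integrable_gauss_rpow ha y)]
  · have : Ioi (0 : ℝ) ⊆
        Function.support (fun t : ℝ => t ^ (a - 1) * Real.exp (-t ^ 2 - 2 * t * y)) ∩ Ioi 0 := by
      intro t ht
      have ht' : 0 < t := ht
      exact ⟨ne_of_gt (by positivity), ht⟩
    refine lt_of_lt_of_le ?_ (measure_mono this)
    simp
  · refine (ae_restrict_iff' measurableSet_Ioi).2 (Eventually.of_forall fun t ht => ?_)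
    have ht' : 0 < t := ht
    simp only [Pi.zero_apply]
    positivity

lemma norm_gaussMellin_le {a : ℂ} (ha : 0 < a.re) {y : ℝ} (hy : 0 ≤ y) :
    ‖gaussMellin a y‖ ≤ ‖gaussMellin (a.re : ℂ) 0‖ := by
  have h0 := gaussMellin_ofReal a.re 0
  rw [Complex.ofReal_zero] at h0
  rw [h0, Complex.norm_real, Real.norm_of_nonneg (gauss_rpow_integral_pos ha 0).le]
  refine norm_integral_le_of_norm_le (integrable_gauss_rpow ha 0) ?_
  refine (ae_restrict_iff' measurableSet_Ioi).2 (Eventually.of_forall fun t ht => ?_)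
  have ht' : 0 < t := ht
  rw [norm_gaussMellin_integrand ht', Complex.ofReal_re]
  gcongr

/-! ### Hermite functions of complex degree -/

/-- Auxiliary function for `hermiteC`, equal to it on `ν.re < n`. -/
noncomputable def hermiteAux : ℕ → ℂ → ℂ → ℂ
  | 0, ν, y => gaussMellin (-ν) y * (Complex.Gamma (-ν))⁻¹
  | n + 1, ν, y => 2 * y * hermiteAux n (ν - 1) y - 2 * (ν - 1) * hermiteAux n (ν - 2) y

/-- The Hermite function `H_ν(y)` of complex degree `ν` and complex argument `y`. -/
noncomputable def hermiteC (ν y : ℂ) : ℂ := hermiteAux (⌊ν.re⌋₊ + 1) ν y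

/-- For degrees of negative real part this is `gaussMellin_recurrence` divided by `Γ(-ν)`, using
`Γ(s + 1) = s Γ(s)` twice; the recurrence propagates it upwards. Hence the continuations of all
stages agree. -/
lemma hermiteAux_succ_eq (n : ℕ) {ν : ℂ} (h : ν.re < n) (y : ℂ) :
    hermiteAux (n + 1) ν y = hermiteAux n ν y := by
  induction n generalizing ν with
  | zero =>
    obtain ⟨a, rfl⟩ : ∃ a, ν = -a := ⟨-ν, (neg_neg ν).symm⟩
    have h0 : 0 < a.re := by simpa using h
    have ha : a ≠ 0 := by rintro rfl; simp at h0
    have ha1 : a + 1 ≠ 0 := by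
      intro h'
      have := congrArg Complex.re h'
      simp at this
      linarith
    have hG : Complex.Gamma a ≠ 0 := Complex.Gamma_ne_zero_of_re_pos h0
    have hr := gaussMellin_recurrence h0 y
    have hG1 := Complex.Gamma_add_one _ ha
    have hG2 := Complex.Gamma_add_one _ ha1
    simp only [hermiteAux]
    rw [show -(-a - 1) = a + 1 by ring, show -(-a - 2) = a + 1 + 1 by ring, neg_neg, hG2, hG1]
    rw [show a + 2 = a + 1 + 1 by ring] at hr
    rw [show -a - 1 = -(a + 1) by ring]
    generalize gaussMellin (a + 1 + 1) y = C at *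
    generalize gaussMellin (a + 1) y = B at *
    generalize gaussMellin a y = A at *
    field_simp
    linear_combination -hr
  | succ n ih =>
    push_cast at h
    rw [hermiteAux, ih (by simp; linarith), ih (by simp; linarith)]
    rfl

lemma hermiteAux_eq_of_le {m n : ℕ} (hmn : m ≤ n) {ν : ℂ} (h : ν.re < m) (y : ℂ) :
    hermiteAux n ν y = hermiteAux m ν y := by
  induction n, hmn using Nat.le_induction with
  | base => rfl
  | succ n hn ih =>
    rw [hermiteAux_succ_eq n (h.trans_le (by exact_mod_cast hn)), ih]

lemma hermiteC_eq_aux {n : ℕ} {ν : ℂ} (h : ν.re < n) (y : ℂ) :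
    hermiteC ν y = hermiteAux n ν y := by
  have h1 : ν.re < (⌊ν.re⌋₊ + 1 : ℕ) := by exact_mod_cast Nat.lt_floor_add_one ν.re
  rcases le_total n (⌊ν.re⌋₊ + 1) with h2 | h2
  · exact hermiteAux_eq_of_le h2 h y
  · exact (hermiteAux_eq_of_le h2 h1 y).symm

lemma hermiteC_of_re_neg {ν : ℂ} (h : ν.re < 0) (y : ℂ) :
    hermiteC ν y = gaussMellin (-ν) y * (Complex.Gamma (-ν))⁻¹ :=
  hermiteC_eq_aux (n := 0) (by simpa using h) y

lemma hermiteC_recurrence (ν y : ℂ) :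
    hermiteC ν y = 2 * y * hermiteC (ν - 1) y - 2 * (ν - 1) * hermiteC (ν - 2) y := by
  have h1 : ν.re < (⌊ν.re⌋₊ + 1 : ℕ) := by exact_mod_cast Nat.lt_floor_add_one ν.re
  have h2 : ν.re < (⌊ν.re⌋₊ + 1 + 1 : ℕ) := by push_cast at h1 ⊢; linarith
  rw [hermiteC_eq_aux h2, hermiteAux, hermiteC_eq_aux (n := ⌊ν.re⌋₊ + 1) (by simp at h1 ⊢; linarith),
    hermiteC_eq_aux (n := ⌊ν.re⌋₊ + 1) (by simp at h1 ⊢; linarith)]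

/-- Induction on the degree along the three-term recurrence. -/
lemma degree_induction {P : ℂ → Prop} (h0 : ∀ ν : ℂ, ν.re < 0 → P ν)
    (hs : ∀ ν, P (ν - 1) → P (ν - 2) → P ν) (ν : ℂ) : P ν := by
  have key : ∀ n : ℕ, ∀ ν : ℂ, ν.re < n → P ν := by
    intro n
    induction n with
    | zero => intro ν h; exact h0 ν (by simpa using h)
    | succ n ih =>
      intro ν h
      push_cast at h
      exact hs ν (ih _ (by simp; linarith)) (ih _ (by simp; linarith))
  exact key (⌊ν.re⌋₊ + 1) ν (by exact_mod_cast Nat.lt_floor_add_one ν.re)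

lemma eventually_re_neg {ν : ℂ} (h : ν.re < 0) : ∀ᶠ w : ℂ in 𝓝 ν, w.re < 0 :=
  Complex.continuous_re.continuousAt.eventually_lt_const h

lemma continuous_hermiteC : Continuous fun p : ℂ × ℂ => hermiteC p.1 p.2 := by
  suffices ∀ ν : ℂ, ∀ y : ℂ, ContinuousAt (fun p : ℂ × ℂ => hermiteC p.1 p.2) (ν, y) from
    continuous_iff_continuousAt.2 fun p => this p.1 p.2
  refine degree_induction (fun ν h y => ?_) (fun ν h1 h2 y => ?_)
  · have h0 : 0 < (-ν).re := by simpa using h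
    have e : (fun p : ℂ × ℂ => hermiteC p.1 p.2) =ᶠ[𝓝 (ν, y)]
        fun p => gaussMellin (-p.1) p.2 * (Complex.Gamma (-p.1))⁻¹ := by
      have h' : ContinuousAt (Prod.fst : ℂ × ℂ → ℂ) (ν, y) := by fun_prop
      have := h'.eventually (eventually_re_neg h)
      filter_upwards [this] with p hp
      exact hermiteC_of_re_neg hp p.2
    refine ContinuousAt.congr ?_ e.symm
    have c1 : ContinuousAt (fun p : ℂ × ℂ => (-p.1, p.2)) (ν, y) := by fun_prop
    have c2 := ContinuousAt.comp (f := fun p : ℂ × ℂ => (-p.1, p.2)) (x := (ν, y))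
      (continuousAt_gaussMellin h0 y) c1
    have c3 : Continuous fun p : ℂ × ℂ => (Complex.Gamma (-p.1))⁻¹ :=
      Complex.differentiable_one_div_Gamma.continuous.comp (continuous_fst.neg)
    exact c2.mul c3.continuousAt
  · have e : (fun p : ℂ × ℂ => hermiteC p.1 p.2) = fun p =>
        2 * p.2 * hermiteC (p.1 - 1) p.2 - 2 * (p.1 - 1) * hermiteC (p.1 - 2) p.2 :=
      funext fun p => hermiteC_recurrence p.1 p.2
    rw [e]
    have c1 : ContinuousAt (fun p : ℂ × ℂ => (p.1 - 1, p.2)) (ν, y) := by fun_prop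
    have c2 : ContinuousAt (fun p : ℂ × ℂ => (p.1 - 2, p.2)) (ν, y) := by fun_prop
    have d1 := ContinuousAt.comp (f := fun p : ℂ × ℂ => (p.1 - 1, p.2)) (x := (ν, y)) (h1 y) c1
    have d2 := ContinuousAt.comp (f := fun p : ℂ × ℂ => (p.1 - 2, p.2)) (x := (ν, y)) (h2 y) c2
    have e1 : ContinuousAt (fun p : ℂ × ℂ => 2 * p.2) (ν, y) := by fun_prop
    have e2 : ContinuousAt (fun p : ℂ × ℂ => 2 * (p.1 - 1)) (ν, y) := by fun_prop
    exact (e1.mul d1).sub (e2.mul d2)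

lemma differentiable_hermiteC_degree (y : ℂ) : Differentiable ℂ fun ν => hermiteC ν y := by
  refine degree_induction (fun ν h => ?_) (fun ν h1 h2 => ?_)
  · have h0 : 0 < (-ν).re := by simpa using h
    have e : (fun ν => hermiteC ν y) =ᶠ[𝓝 ν]
        fun ν => gaussMellin (-ν) y * (Complex.Gamma (-ν))⁻¹ := by
      filter_upwards [eventually_re_neg h] with w hw
      exact hermiteC_of_re_neg hw y
    refine DifferentiableAt.congr_of_eventuallyEq ?_ e
    have n1 : DifferentiableAt ℂ (fun ν : ℂ => -ν) ν := by fun_prop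
    exact (DifferentiableAt.comp ν (differentiableAt_gaussMellin h0 y) n1).mul
      (DifferentiableAt.comp (g := fun s => (Complex.Gamma s)⁻¹) ν
        (Complex.differentiable_one_div_Gamma _) n1)
  · have e : (fun ν => hermiteC ν y) = fun ν =>
        2 * y * hermiteC (ν - 1) y - 2 * (ν - 1) * hermiteC (ν - 2) y :=
      funext fun p => hermiteC_recurrence p y
    rw [e]
    have d1 : DifferentiableAt ℂ (fun ν => hermiteC (ν - 1) y) ν :=
      DifferentiableAt.comp (f := fun ν : ℂ => ν - 1) ν h1 (by fun_prop)
    have d2 : DifferentiableAt ℂ (fun ν => hermiteC (ν - 2) y) ν :=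
      DifferentiableAt.comp (f := fun ν : ℂ => ν - 2) ν h2 (by fun_prop)
    exact (d1.const_mul _).sub ((by fun_prop : DifferentiableAt ℂ (fun ν : ℂ => 2 * (ν - 1)) ν).mul d2)

/-- For negative real part, differentiation under the integral shifts the Mellin exponent by one and
`Γ(1 - ν) = -ν Γ(-ν)` supplies the factor; the recurrence extends the formula to all degrees. -/
lemma hasDerivAt_hermiteC (ν y : ℂ) :
    HasDerivAt (hermiteC ν) (2 * ν * hermiteC (ν - 1) y) y := by
  revert y
  refine degree_induction (P := fun ν => ∀ y, HasDerivAt (hermiteC ν)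
    (2 * ν * hermiteC (ν - 1) y) y) (fun ν h y => ?_) (fun ν h1 h2 y => ?_) ν
  · have h0 : 0 < (-ν).re := by simpa using h
    have hν : -ν ≠ 0 := by intro h'; rw [h'] at h0; simp at h0
    have e : hermiteC ν = fun y => gaussMellin (-ν) y * (Complex.Gamma (-ν))⁻¹ :=
      funext fun y => hermiteC_of_re_neg h y
    rw [e]
    refine ((hasDerivAt_gaussMellin h0 y).mul_const _).congr_deriv ?_
    rw [hermiteC_of_re_neg (by simp; linarith), show -(ν - 1) = -ν + 1 by ring,
      Complex.Gamma_add_one _ hν]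
    have hG : Complex.Gamma (-ν) ≠ 0 := Complex.Gamma_ne_zero_of_re_pos h0
    have hν' : ν ≠ 0 := neg_ne_zero.1 hν
    field_simp
  · have e : hermiteC ν = fun y =>
        2 * y * hermiteC (ν - 1) y - 2 * (ν - 1) * hermiteC (ν - 2) y :=
      funext fun y => hermiteC_recurrence ν y
    rw [e]
    have h3 := (((hasDerivAt_id' y).const_mul 2).mul (h1 y)).sub ((h2 y).const_mul (2 * (ν - 1)))
    refine h3.congr_deriv ?_
    have r := hermiteC_recurrence (ν - 1) y
    rw [show ν - 1 - 1 = ν - 2 by ring, show ν - 1 - 2 = ν - 3 by ring] at r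
    rw [show ν - 1 - 1 = ν - 2 by ring, show ν - 2 - 1 = ν - 3 by ring]
    linear_combination -2 * (ν - 1) * r

lemma hermiteC_zero (y : ℂ) : hermiteC 0 y = 1 := by
  rw [hermiteC_recurrence, hermiteC_of_re_neg (by simp), hermiteC_of_re_neg (by simp)]
  have h := gaussMellin_one_two y
  have : Complex.Gamma 2 = 1 := by
    have := Complex.Gamma_add_one 1 one_ne_zero
    rwa [Complex.Gamma_one, mul_one, one_add_one_eq_two] at this
  simp only [zero_sub, neg_neg, Complex.Gamma_one, this]
  linear_combination h

lemma hermiteC_im (ν y : ℝ) : (hermiteC ν y).im = 0 := by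
  suffices ∀ ν : ℂ, ν.im = 0 → (hermiteC ν y).im = 0 from this ν (Complex.ofReal_im ν)
  refine degree_induction (fun ν h hi => ?_) (fun ν h1 h2 hi => ?_)
  · obtain ⟨r, rfl⟩ : ∃ r : ℝ, ν = r := ⟨ν.re, Complex.ext rfl (by simpa using hi)⟩
    rw [hermiteC_of_re_neg h, ← Complex.ofReal_neg, gaussMellin_ofReal, Complex.Gamma_ofReal,
      ← Complex.ofReal_inv, ← Complex.ofReal_mul, Complex.ofReal_im]
  · rw [hermiteC_recurrence]
    have i1 := h1 (by simpa using hi)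
    have i2 := h2 (by simpa using hi)
    simp [Complex.mul_im, i1, i2, hi]

lemma hermiteC_re_pos {ν : ℝ} (hν : ν < 0) (y : ℝ) : 0 < (hermiteC ν y).re := by
  rw [hermiteC_of_re_neg (by simpa using hν), ← Complex.ofReal_neg, gaussMellin_ofReal,
    Complex.Gamma_ofReal, ← Complex.ofReal_inv, ← Complex.ofReal_mul, Complex.ofReal_re]
  exact mul_pos (gauss_rpow_integral_pos (by linarith) y)
    (inv_pos.2 (Real.Gamma_pos_of_pos (by linarith)))

/-- The bound is uniform for degrees near `ν`, so that Cauchy's estimate can transfer it to the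
derivative in the degree. -/
lemma norm_hermiteC_le (ν : ℂ) : ∃ C : ℝ, ∃ N : ℕ, ∀ᶠ w in 𝓝 ν, ∀ y : ℝ, 0 ≤ y →
    ‖hermiteC w y‖ ≤ C * (1 + y) ^ N := by
  revert ν
  refine degree_induction (fun ν h => ?_) (fun ν h1 h2 => ?_)
  · have h0 : 0 < (-ν).re := by simpa using h
    let f : ℂ → ℝ := fun w => ‖gaussMellin ((-w).re : ℂ) 0 * (Complex.Gamma (-w))⁻¹‖
    have hf : ContinuousAt f ν := by
      have n1 : ContinuousAt (fun w : ℂ => ((-w).re : ℂ)) ν := by fun_prop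
      have n2 : ContinuousAt (fun w : ℂ => -w) ν := by fun_prop
      have c1 : ContinuousAt (fun a => gaussMellin a 0) ((-ν).re : ℂ) :=
        (differentiableAt_gaussMellin (by simpa using h0) 0).continuousAt
      exact ((ContinuousAt.comp (f := fun w : ℂ => ((-w).re : ℂ)) c1 n1).mul
        (Complex.differentiable_one_div_Gamma.continuous.continuousAt.comp n2)).norm
    refine ⟨f ν + 1, 0, ?_⟩
    filter_upwards [eventually_re_neg h, hf.eventually_lt_const (lt_add_one _)] with w hw hw' y hy
    rw [hermiteC_of_re_neg hw, pow_zero, mul_one, norm_mul]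
    refine le_trans ?_ hw'.le
    simp only [f]
    rw [norm_mul]
    gcongr
    exact norm_gaussMellin_le (by simpa using hw) hy
  · obtain ⟨C1, N1, h1⟩ := h1
    obtain ⟨C2, N2, h2⟩ := h2
    have n1 : ContinuousAt (fun w : ℂ => w - 1) ν := by fun_prop
    have n2 : ContinuousAt (fun w : ℂ => w - 2) ν := by fun_prop
    have n3 : ContinuousAt (fun w : ℂ => ‖w - 1‖) ν := by fun_prop
    refine ⟨2 * |C1| + 2 * (‖ν - 1‖ + 1) * |C2|, N1 + N2 + 1, ?_⟩
    filter_upwards [n1.eventually h1, n2.eventually h2,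
      n3.eventually_lt_const (lt_add_one _)] with w h1 h2 h3 y hy
    have k1 := (h1 y hy).trans (mul_le_mul_of_nonneg_right (le_abs_self C1) (by positivity))
    have k2 := (h2 y hy).trans (mul_le_mul_of_nonneg_right (le_abs_self C2) (by positivity))
    have p1 : (1 + y) ^ N1 * y ≤ (1 + y) ^ (N1 + N2 + 1) := by
      calc (1 + y) ^ N1 * y ≤ (1 + y) ^ N1 * (1 + y) ^ (N2 + 1) := by
            gcongr
            rw [pow_succ]
            nlinarith [one_le_pow₀ (n := N2) (by linarith : (1 : ℝ) ≤ 1 + y)]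
        _ = _ := by ring
    have p2 : (1 + y) ^ N2 ≤ (1 + y) ^ (N1 + N2 + 1) :=
      pow_le_pow_right₀ (by linarith) (by omega)
    rw [hermiteC_recurrence]
    calc ‖2 * (y : ℂ) * hermiteC (w - 1) y - 2 * (w - 1) * hermiteC (w - 2) y‖
        ≤ 2 * y * ‖hermiteC (w - 1) y‖ + 2 * ‖w - 1‖ * ‖hermiteC (w - 2) y‖ := by
          refine (norm_sub_le _ _).trans (le_of_eq ?_)
          simp only [norm_mul, Complex.norm_ofNat, Complex.norm_real, Real.norm_of_nonneg hy]
      _ ≤ 2 * y * (|C1| * (1 + y) ^ N1) + 2 * (‖ν - 1‖ + 1) * (|C2| * (1 + y) ^ N2) := by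
          gcongr
      _ = 2 * |C1| * ((1 + y) ^ N1 * y) + 2 * (‖ν - 1‖ + 1) * |C2| * (1 + y) ^ N2 := by ring
      _ ≤ 2 * |C1| * (1 + y) ^ (N1 + N2 + 1)
          + 2 * (‖ν - 1‖ + 1) * |C2| * (1 + y) ^ (N1 + N2 + 1) := by gcongr
      _ = _ := by ring

/-- The derivative of the Hermite function with respect to its degree. -/
noncomputable def hermiteCDeg (ν y : ℂ) : ℂ := deriv (fun ν => hermiteC ν y) ν

lemma hasDerivAt_hermiteC_degree (ν y : ℂ) :
    HasDerivAt (fun ν => hermiteC ν y) (hermiteCDeg ν y) ν :=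
  (differentiable_hermiteC_degree y ν).hasDerivAt

lemma norm_hermiteCDeg_le (ν : ℂ) : ∃ C : ℝ, ∃ N : ℕ, ∀ y : ℝ, 0 ≤ y →
    ‖hermiteCDeg ν y‖ ≤ C * (1 + y) ^ N := by
  obtain ⟨C, N, h⟩ := norm_hermiteC_le ν
  obtain ⟨ε, hε, h⟩ := Metric.eventually_nhds_iff_ball.1 h
  refine ⟨C / (ε / 2), N, fun y hy => ?_⟩
  have := Complex.norm_deriv_le_of_forall_mem_sphere_norm_le (c := ν) (R := ε / 2)
    (f := fun ν => hermiteC ν y) (C := C * (1 + y) ^ N) (by positivity)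
    (differentiable_hermiteC_degree y).diffContOnCl
    (fun z hz => h z (by
      rw [Metric.mem_ball, Metric.mem_sphere.1 hz]; linarith) y hy)
  refine this.trans (le_of_eq (by ring))

/-- The derivative in the first variable of a jointly continuous function, holomorphic in the first
variable, is jointly continuous. -/
lemma continuous_deriv_left_of_continuous {f : ℂ → ℂ → ℂ}
    (hf : Continuous fun p : ℂ × ℂ => f p.1 p.2) (hd : ∀ y, Differentiable ℂ fun x => f x y) :
    Continuous fun p : ℂ × ℂ => deriv (fun x => f x p.2) p.1 := by
  refine continuous_iff_continuousAt.2 fun ⟨x, y⟩ => ?_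
  -- The slices `f · y` depend continuously on `y` in the compact-open topology, so they converge
  -- locally uniformly; for holomorphic functions the derivatives then do too.
  let F : C(ℂ × ℂ, ℂ) := ⟨fun p => f p.2 p.1, hf.comp continuous_swap⟩
  have h1 := ContinuousMap.tendsto_iff_tendstoLocallyUniformly.1 (F.curry.continuous.tendsto y)
  have h2 := (tendstoLocallyUniformlyOn_univ.2 h1).deriv
    (Eventually.of_forall fun z => (hd z).differentiableOn) isOpen_univ
  have h3 := (tendstoLocallyUniformly_iff_forall_tendsto.1 (tendstoLocallyUniformlyOn_univ.1 h2)) x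
  have h4 : Tendsto (fun p : ℂ × ℂ => deriv (fun x => f x y) p.2) (𝓝 y ×ˢ 𝓝 x)
      (𝓝 (deriv (fun x => f x y) x)) :=
    ((hd y).deriv.continuous.tendsto x).comp tendsto_snd
  have h5 : Tendsto (fun p : ℂ × ℂ => deriv (fun x => f x p.1) p.2) (𝓝 y ×ˢ 𝓝 x)
      (𝓝 (deriv (fun x => f x y) x)) := h4.congr_uniformity h3
  rw [ContinuousAt, nhds_prod_eq]
  exact h5.comp tendsto_prod_swap

lemma continuous_hermiteCDeg : Continuous fun p : ℂ × ℂ => hermiteCDeg p.1 p.2 :=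
  continuous_deriv_left_of_continuous continuous_hermiteC differentiable_hermiteC_degree

/-! ### Hermite functions of real degree -/

/-- The Hermite function of real degree and real argument. -/
noncomputable def hermiteR (ν y : ℝ) : ℝ := (hermiteC ν y).re

/-- The derivative of `hermiteR` with respect to the degree. -/
noncomputable def hermiteRDeg (ν y : ℝ) : ℝ := (hermiteCDeg ν y).re

lemma hermiteC_ofReal (ν y : ℝ) : hermiteC ν y = (hermiteR ν y : ℂ) :=
  Complex.ext rfl (hermiteC_im ν y)

lemma hermiteR_recurrence (ν y : ℝ) :
    hermiteR ν y = 2 * y * hermiteR (ν - 1) y - 2 * (ν - 1) * hermiteR (ν - 2) y := by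
  have h := hermiteC_recurrence ν y
  have e1 : (ν : ℂ) - 1 = ((ν - 1 : ℝ) : ℂ) := by push_cast; rfl
  have e2 : (ν : ℂ) - 2 = ((ν - 2 : ℝ) : ℂ) := by push_cast; rfl
  rw [e1, e2, hermiteC_ofReal, hermiteC_ofReal, hermiteC_ofReal] at h
  exact_mod_cast h

lemma hasDerivAt_hermiteR (ν y : ℝ) :
    HasDerivAt (hermiteR ν) (2 * ν * hermiteR (ν - 1) y) y := by
  refine (hasDerivAt_hermiteC ν y).real_of_complex.congr_deriv ?_
  have e1 : (ν : ℂ) - 1 = ((ν - 1 : ℝ) : ℂ) := by push_cast; rfl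
  rw [e1, hermiteC_ofReal]
  norm_cast

lemma hasDerivAt_hermiteR_degree (ν y : ℝ) :
    HasDerivAt (fun ν => hermiteR ν y) (hermiteRDeg ν y) ν :=
  (hasDerivAt_hermiteC_degree ν y).real_of_complex

lemma hermiteCDeg_ofReal (ν y : ℝ) : hermiteCDeg ν y = (hermiteRDeg ν y : ℂ) := by
  have h1 := (hasDerivAt_hermiteC_degree ν y).comp_ofReal
  have h2 := (hasDerivAt_hermiteR_degree ν y).ofReal_comp
  have e : (fun ν : ℝ => hermiteC ν y) = fun ν : ℝ => (hermiteR ν y : ℂ) :=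
    funext fun ν => hermiteC_ofReal ν y
  rw [e] at h1
  exact h1.unique h2

lemma continuous_hermiteR : Continuous fun p : ℝ × ℝ => hermiteR p.1 p.2 :=
  Complex.continuous_re.comp (continuous_hermiteC.comp
    ((Complex.continuous_ofReal.comp continuous_fst).prodMk
      (Complex.continuous_ofReal.comp continuous_snd)))

lemma continuous_hermiteRDeg : Continuous fun p : ℝ × ℝ => hermiteRDeg p.1 p.2 :=
  Complex.continuous_re.comp (continuous_hermiteCDeg.comp
    ((Complex.continuous_ofReal.comp continuous_fst).prodMk
      (Complex.continuous_ofReal.comp continuous_snd)))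

@[fun_prop]
lemma continuous_hermiteR_comp {X : Type*} [TopologicalSpace X] {f g : X → ℝ} (hf : Continuous f)
    (hg : Continuous g) : Continuous fun x => hermiteR (f x) (g x) :=
  continuous_hermiteR.comp (hf.prodMk hg)

@[fun_prop]
lemma continuous_hermiteRDeg_comp {X : Type*} [TopologicalSpace X] {f g : X → ℝ} (hf : Continuous f)
    (hg : Continuous g) : Continuous fun x => hermiteRDeg (f x) (g x) :=
  Continuous.comp (g := fun p : ℝ × ℝ => hermiteRDeg p.1 p.2) (f := fun x => (f x, g x))
    continuous_hermiteRDeg (hf.prodMk hg)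

lemma hermiteR_zero (y : ℝ) : hermiteR 0 y = 1 := by
  simp [hermiteR, hermiteC_zero]

lemma hermiteR_pos {ν : ℝ} (hν : ν < 0) (y : ℝ) : 0 < hermiteR ν y := hermiteC_re_pos hν y

lemma hermiteRDeg_recurrence (ν y : ℝ) :
    hermiteRDeg ν y = 2 * y * hermiteRDeg (ν - 1) y - 2 * hermiteR (ν - 2) y
      - 2 * (ν - 1) * hermiteRDeg (ν - 2) y := by
  have h1 := (hasDerivAt_hermiteR_degree (ν - 1) y).comp_sub_const ν 1
  have h2 := (hasDerivAt_hermiteR_degree (ν - 2) y).comp_sub_const ν 2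
  have h3 : HasDerivAt (fun ν : ℝ => 2 * (ν - 1)) 2 ν := by
    simpa using ((hasDerivAt_id' ν).sub_const 1).const_mul 2
  have h4 := (h1.const_mul (2 * y)).fun_sub (h3.fun_mul h2)
  have e : (fun ν => hermiteR ν y) = fun ν =>
      2 * y * hermiteR (ν - 1) y - 2 * (ν - 1) * hermiteR (ν - 2) y :=
    funext fun ν => hermiteR_recurrence ν y
  have h5 := hasDerivAt_hermiteR_degree ν y
  rw [e] at h5
  rw [h5.unique h4]
  ring

/-- Exchange of the order of two partial derivatives. -/
lemma hasDerivAt_deriv_left_of_continuous {f fx fy fxy : ℝ → ℝ → ℝ}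
    (hx : ∀ x y, HasDerivAt (fun x => f x y) (fx x y) x) (hy : ∀ x y, HasDerivAt (f x) (fy x y) y)
    (hxy : ∀ x y, HasDerivAt (fun x => fy x y) (fxy x y) x)
    (cy : Continuous fun p : ℝ × ℝ => fy p.1 p.2)
    (cxy : Continuous fun p : ℝ × ℝ => fxy p.1 p.2) (x y : ℝ) :
    HasDerivAt (fx x) (fxy x y) y := by
  have cy' : ∀ x, Continuous (fy x) := fun x => cy.comp (continuous_const.prodMk continuous_id)
  have cxy' : ∀ x, Continuous (fxy x) := fun x => cxy.comp (continuous_const.prodMk continuous_id)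
  -- Write `f x y - f x 0` as the integral of `fy x` and differentiate under the integral sign in
  -- `x`.
  have key : ∀ y, fx x y = fx x 0 + ∫ s in (0 : ℝ)..y, fxy x s := by
    intro y
    obtain ⟨C, hC⟩ := ((isCompact_closedBall x 1).prod (isCompact_uIcc (a := (0 : ℝ))
      (b := y))).exists_bound_of_continuousOn cxy.continuousOn
    have h1 := (intervalIntegral.hasDerivAt_integral_of_dominated_loc_of_deriv_le
      (μ := volume) (a := 0) (b := y) (F := fun x s => fy x s) (F' := fun x s => fxy x s)
      (x₀ := x) (s := Metric.closedBall x 1) (bound := fun _ => C)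
      (Metric.closedBall_mem_nhds x one_pos)
      (Eventually.of_forall fun z => (cy' z).aestronglyMeasurable)
      ((cy' x).intervalIntegrable _ _) (cxy' x).aestronglyMeasurable
      (Eventually.of_forall fun s hs z hz => hC (z, s) ⟨hz, uIoc_subset_uIcc hs⟩)
      intervalIntegrable_const
      (Eventually.of_forall fun s hs z hz => hxy z s)).2
    have e : (fun x => f x y) = fun x => f x 0 + ∫ s in (0 : ℝ)..y, fy x s := by
      funext z
      rw [intervalIntegral.integral_eq_sub_of_hasDerivAt (fun s _ => hy z s)
        ((cy' z).intervalIntegrable _ _)]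
      ring
    have h2 := hx x y
    rw [e] at h2
    exact h2.unique ((hx x 0).add h1)
  have e : fx x = fun y => fx x 0 + ∫ s in (0 : ℝ)..y, fxy x s := funext key
  rw [e]
  exact (intervalIntegral.integral_hasDerivAt_right ((cxy' x).intervalIntegrable _ _)
    ((cxy' x).stronglyMeasurableAtFilter _ _) (cxy' x).continuousAt).const_add _

lemma hasDerivAt_hermiteRDeg (ν y : ℝ) :
    HasDerivAt (hermiteRDeg ν) (2 * hermiteR (ν - 1) y + 2 * ν * hermiteRDeg (ν - 1) y) y := by
  refine hasDerivAt_deriv_left_of_continuous (f := hermiteR)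
    (fy := fun ν y => 2 * ν * hermiteR (ν - 1) y)
    (fxy := fun ν y => 2 * hermiteR (ν - 1) y + 2 * ν * hermiteRDeg (ν - 1) y)
    hasDerivAt_hermiteR_degree hasDerivAt_hermiteR (fun ν y => ?_) (by fun_prop) (by fun_prop) ν y
  have h1 := (hasDerivAt_hermiteR_degree (ν - 1) y).comp_sub_const ν 1
  have h3 : HasDerivAt (fun ν : ℝ => 2 * ν) 2 ν := by
    simpa using (hasDerivAt_id' ν).const_mul 2
  exact h3.fun_mul h1

/-! ### Polynomial growth against the Gaussian -/

/-- At most polynomial growth at `+∞`. -/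
def PolyGrowth (f : ℝ → ℝ) : Prop := ∃ C : ℝ, ∃ N : ℕ, ∀ y, 0 ≤ y → |f y| ≤ C * (1 + y) ^ N

lemma PolyGrowth.add {f g : ℝ → ℝ} (hf : PolyGrowth f) (hg : PolyGrowth g) :
    PolyGrowth fun y => f y + g y := by
  obtain ⟨C, N, hf⟩ := hf
  obtain ⟨D, M, hg⟩ := hg
  refine ⟨|C| + |D|, N + M, fun y hy => ?_⟩
  have a1 : (1 + y) ^ N ≤ (1 + y) ^ (N + M) := pow_le_pow_right₀ (by linarith) (by omega)
  have a2 : (1 + y) ^ M ≤ (1 + y) ^ (N + M) := pow_le_pow_right₀ (by linarith) (by omega)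
  calc |f y + g y| ≤ |f y| + |g y| := abs_add_le _ _
    _ ≤ C * (1 + y) ^ N + D * (1 + y) ^ M := add_le_add (hf y hy) (hg y hy)
    _ ≤ |C| * (1 + y) ^ N + |D| * (1 + y) ^ M := by gcongr <;> exact le_abs_self _
    _ ≤ |C| * (1 + y) ^ (N + M) + |D| * (1 + y) ^ (N + M) := by gcongr
    _ = _ := by ring

lemma PolyGrowth.mul {f g : ℝ → ℝ} (hf : PolyGrowth f) (hg : PolyGrowth g) :
    PolyGrowth fun y => f y * g y := by
  obtain ⟨C, N, hf⟩ := hf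
  obtain ⟨D, M, hg⟩ := hg
  refine ⟨C * D, N + M, fun y hy => ?_⟩
  rw [abs_mul]
  calc |f y| * |g y| ≤ (C * (1 + y) ^ N) * (D * (1 + y) ^ M) :=
        mul_le_mul (hf y hy) (hg y hy) (abs_nonneg _) ((abs_nonneg _).trans (hf y hy))
    _ = _ := by ring

lemma polyGrowth_const (c : ℝ) : PolyGrowth fun _ => c := ⟨|c|, 0, by simp⟩

lemma polyGrowth_id : PolyGrowth fun y => y :=
  ⟨1, 1, fun y hy => by rw [abs_of_nonneg hy]; linarith⟩

lemma PolyGrowth.neg {f : ℝ → ℝ} (hf : PolyGrowth f) : PolyGrowth fun y => -f y := by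
  obtain ⟨C, N, hf⟩ := hf
  exact ⟨C, N, fun y hy => by rw [abs_neg]; exact hf y hy⟩

lemma PolyGrowth.sub {f g : ℝ → ℝ} (hf : PolyGrowth f) (hg : PolyGrowth g) :
    PolyGrowth fun y => f y - g y := by
  simpa only [sub_eq_add_neg] using hf.add hg.neg

lemma PolyGrowth.gauss_isBigO {f : ℝ → ℝ} (hf : PolyGrowth f) :
    (fun y => Real.exp (-y ^ 2 / 2) * f y) =O[atTop] fun y => Real.exp (-1 * y) := by
  obtain ⟨C, N, hf⟩ := hf
  refine Asymptotics.IsBigO.of_bound (|C| * N.factorial * Real.exp 1) ?_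
  filter_upwards [eventually_ge_atTop 4] with y hy
  have h1 := Real.pow_div_factorial_le_exp (1 + y) (by linarith) N
  rw [div_le_iff₀ (by positivity)] at h1
  have h2 : |f y| ≤ |C| * (Real.exp (1 + y) * N.factorial) :=
    (hf y (by linarith)).trans (mul_le_mul (le_abs_self C) h1 (by positivity) (abs_nonneg _))
  rw [norm_mul, Real.norm_eq_abs, Real.norm_eq_abs, Real.abs_exp, Real.norm_eq_abs, Real.abs_exp]
  -- For `4 ≤ y` one has `2y ≤ y²/2`; one factor `exp (-y)` absorbs the `exp (1 + y)` bounding the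
  -- polynomial, the other is the claimed decay.
  have h3 : Real.exp (-y ^ 2 / 2) ≤ Real.exp (-1 * y - y) :=
    Real.exp_le_exp.2 (by nlinarith)
  calc Real.exp (-y ^ 2 / 2) * |f y|
      ≤ Real.exp (-1 * y - y) * (|C| * (Real.exp (1 + y) * N.factorial)) := by gcongr
    _ = |C| * N.factorial * (Real.exp (-1 * y - y) * Real.exp (1 + y)) := by ring
    _ = |C| * N.factorial * (Real.exp 1 * Real.exp (-1 * y)) := by
        rw [← Real.exp_add, ← Real.exp_add]; ring_nf
    _ = _ := by ring

lemma tendsto_exp_neg_atTop : Tendsto (fun y : ℝ => Real.exp (-1 * y)) atTop (𝓝 0) := by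
  simpa using Real.tendsto_exp_neg_atTop_nhds_zero

lemma PolyGrowth.gauss_tendsto {f : ℝ → ℝ} (hf : PolyGrowth f) :
    Tendsto (fun y => Real.exp (-y ^ 2 / 2) * f y) atTop (𝓝 0) :=
  hf.gauss_isBigO.trans_tendsto tendsto_exp_neg_atTop

lemma polyGrowth_hermiteR (ν : ℝ) : PolyGrowth (hermiteR ν) := by
  obtain ⟨C, N, h⟩ := norm_hermiteC_le ν
  refine ⟨C, N, fun y hy => ?_⟩
  have := h.self_of_nhds y hy
  rwa [hermiteC_ofReal, Complex.norm_real] at this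

lemma polyGrowth_hermiteRDeg (ν : ℝ) : PolyGrowth (hermiteRDeg ν) := by
  obtain ⟨C, N, h⟩ := norm_hermiteCDeg_le ν
  refine ⟨C, N, fun y hy => ?_⟩
  have := h y hy
  rwa [hermiteCDeg_ofReal, Complex.norm_real] at this

/-! ### Zeros, parity and asymptotic sign of Hermite functions -/

/-- Two consecutive Hermite functions have no common zero. -/
lemma hermiteR_ne_zero_of_eq_zero {ν y : ℝ} (h : hermiteR ν y = 0) :
    ν * hermiteR (ν - 1) y ≠ 0 := by
  -- Descent: by the recurrence a common zero passes to the next lower pair of degrees, until it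
  -- meets `H_0 = 1` or a negative degree, where the Hermite function is positive.
  have key : ∀ n : ℕ, ∀ ν : ℝ, ν < n → hermiteR ν y = 0 → ν * hermiteR (ν - 1) y ≠ 0 := by
    intro n
    induction n with
    | zero =>
      intro ν hν h
      exact absurd h (hermiteR_pos (by simpa using hν) y).ne'
    | succ n ih =>
      intro ν hν h h1
      push_cast at hν
      rcases mul_eq_zero.1 h1 with rfl | h1
      · rw [hermiteR_zero] at h
        exact one_ne_zero h
      · refine ih (ν - 1) (by linarith) h1 ?_
        have r := hermiteR_recurrence ν y
        rw [h, h1] at r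
        rw [show ν - 1 - 1 = ν - 2 by ring]
        linarith
  exact key (⌊ν⌋₊ + 1) ν (by exact_mod_cast Nat.lt_floor_add_one ν) h

lemma hermiteR_at_zero (ν : ℝ) : hermiteR ν 0 = -(2 * (ν - 1)) * hermiteR (ν - 2) 0 := by
  rw [hermiteR_recurrence]; ring

/-- At `y = 0` the recurrence reads `H_ν = -2(ν - 1) H_{ν-2}`: descending by two, a zero can only
come from the factor `ν - 1`, since negative degrees give positive values. -/
lemma hermiteR_at_zero_eq_zero_iff (ν : ℝ) :
    hermiteR ν 0 = 0 ↔ ∃ n : ℕ, ν = 2 * n + 1 := by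
  constructor
  · have key : ∀ n : ℕ, ∀ ν : ℝ, ν < n → hermiteR ν 0 = 0 → ∃ n : ℕ, ν = 2 * n + 1 := by
      intro n
      induction n with
      | zero =>
        intro ν hν h
        exact absurd h (hermiteR_pos (by simpa using hν) 0).ne'
      | succ n ih =>
        intro ν hν h
        push_cast at hν
        rw [hermiteR_at_zero] at h
        rcases mul_eq_zero.1 h with h | h
        · exact ⟨0, by norm_num; linarith⟩
        · obtain ⟨m, hm⟩ := ih (ν - 2) (by linarith) h
          exact ⟨m + 1, by push_cast; linarith⟩
    exact key (⌊ν⌋₊ + 1) ν (by exact_mod_cast Nat.lt_floor_add_one ν)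
  · rintro ⟨n, rfl⟩
    induction n with
    | zero => rw [hermiteR_at_zero]; simp
    | succ n ih =>
      rw [hermiteR_at_zero]
      push_cast
      rw [show 2 * ((n : ℝ) + 1) + 1 - 2 = 2 * n + 1 by ring, ih, mul_zero]

lemma hermiteR_nat_succ (n : ℕ) (y : ℝ) :
    hermiteR (n + 1 : ℕ) y = 2 * y * hermiteR n y - 2 * n * hermiteR ((n : ℝ) - 1) y := by
  rw [hermiteR_recurrence]
  push_cast
  rw [show (n : ℝ) + 1 - 1 = n by ring, show (n : ℝ) + 1 - 2 = n - 1 by ring]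

/-- The recurrence satisfied by the Hermite functions of integral degree. -/
lemma hermiteR_nat_succ_succ (n : ℕ) (y : ℝ) : hermiteR (n + 2 : ℕ) y =
    2 * y * hermiteR (n + 1 : ℕ) y - 2 * (n + 1) * hermiteR n y := by
  rw [hermiteR_nat_succ]
  push_cast
  rw [show (n : ℝ) + 1 - 1 = n by ring]

lemma hermiteR_one (y : ℝ) : hermiteR (1 : ℕ) y = 2 * y := by
  have := hermiteR_nat_succ 0 y
  simpa [hermiteR_zero] using this

lemma hermiteR_nat_neg (n : ℕ) (y : ℝ) : hermiteR n (-y) = (-1) ^ n * hermiteR n y := by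
  induction n using Nat.twoStepInduction with
  | zero => simp [hermiteR_zero]
  | one => rw [hermiteR_one, hermiteR_one]; ring
  | more n h1 h2 =>
    rw [hermiteR_nat_succ_succ, hermiteR_nat_succ_succ, h1, h2]
    ring

lemma exists_polynomial_hermiteR (n : ℕ) :
    ∃ p : Polynomial ℝ, p.natDegree ≤ n ∧ ∀ y, hermiteR n y = p.eval y := by
  induction n using Nat.twoStepInduction with
  | zero => exact ⟨1, by simp, by simp [hermiteR_zero]⟩
  | one =>
    refine ⟨Polynomial.C 2 * Polynomial.X, ?_, fun y => ?_⟩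
    · exact (Polynomial.natDegree_C_mul_le _ _).trans Polynomial.natDegree_X_le
    · rw [hermiteR_one]; simp
  | more n h1 h2 =>
    obtain ⟨p, hp, hp'⟩ := h1
    obtain ⟨q, hq, hq'⟩ := h2
    refine ⟨Polynomial.C (2 : ℝ) * Polynomial.X * q - Polynomial.C (2 * ((n : ℝ) + 1)) * p, ?_, fun y => ?_⟩
    · refine (Polynomial.natDegree_sub_le _ _).trans (max_le ?_ ?_)
      · refine Polynomial.natDegree_mul_le.trans ?_
        have : (Polynomial.C (2 : ℝ) * Polynomial.X).natDegree ≤ 1 :=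
          (Polynomial.natDegree_C_mul_le _ _).trans Polynomial.natDegree_X_le
        omega
      · exact (Polynomial.natDegree_C_mul_le _ _).trans (by omega)
    · rw [hermiteR_nat_succ_succ, hp', hq']
      simp

lemma tendsto_atBot_atTop_of_deriv_le_neg {F F' : ℝ → ℝ} {c Y : ℝ} (hc : 0 < c)
    (hF : ∀ y, HasDerivAt F (F' y) y) (h : ∀ y ≤ Y, F' y ≤ -c) : Tendsto F atBot atTop := by
  have hG : AntitoneOn (fun y => F y + c * y) (Iic Y) := by
    have hd : ∀ y, HasDerivAt (fun y => F y + c * y) (F' y + c) y := fun y => by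
      simpa using (hF y).fun_add ((hasDerivAt_id' y).const_mul c)
    refine antitoneOn_of_deriv_nonpos (convex_Iic Y)
      (fun y _ => (hd y).continuousAt.continuousWithinAt)
      (fun y _ => (hd y).differentiableAt.differentiableWithinAt) fun y hy => ?_
    rw [interior_Iic] at hy
    rw [(hd y).deriv]
    linarith [h y (le_of_lt hy)]
  have h1 : Tendsto (fun y : ℝ => F Y + c * Y + (-c) * y) atBot atTop :=
    tendsto_atTop_add_const_left _ _ (tendsto_id.const_mul_atBot_of_neg (by linarith))
  refine tendsto_atTop_mono' _ ?_ h1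
  filter_upwards [eventually_le_atBot Y] with y hy
  have := hG (mem_Iic.2 hy) (mem_Iic.2 le_rfl) hy
  simp only at this
  linarith

/-- Induction through `H_ν' = 2ν H_{ν-1}`: a derivative bounded away from zero near `-∞` forces
divergence with the opposite sign. For `0 < ν < 1` the derivative is positive and decreasing in `y`.
-/
lemma hermiteR_tendsto_atBot (n : ℕ) {ν : ℝ} (h1 : n < ν) (h2 : ν < n + 1) :
    Tendsto (fun y => (-1) ^ (n + 1) * hermiteR ν y) atBot atTop := by
  induction n generalizing ν with
  | zero =>
    simp only [Nat.cast_zero, zero_add] at h1 h2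
    have hp := hermiteR_pos (ν := ν - 1) (by linarith) 0
    refine tendsto_atBot_atTop_of_deriv_le_neg (c := 2 * ν * hermiteR (ν - 1) 0) (Y := 0)
      (by positivity) (fun y => (hasDerivAt_hermiteR ν y).const_mul _) fun y hy => ?_
    have ha : Antitone (hermiteR (ν - 1)) := by
      refine antitone_of_hasDerivAt_nonpos (fun y => hasDerivAt_hermiteR (ν - 1) y) fun y => ?_
      have := hermiteR_pos (ν := ν - 1 - 1) (by linarith) y
      simp only [Pi.zero_apply]
      nlinarith
    have := mul_le_mul_of_nonneg_left (ha hy) (by positivity : 0 ≤ 2 * ν)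
    rw [pow_one]
    linarith
  | succ n ih =>
    push_cast at h1 h2
    have hν : 0 < ν := by
      have : (0 : ℝ) ≤ n := n.cast_nonneg
      linarith
    have ih := ih (ν := ν - 1) (by linarith) (by linarith)
    obtain ⟨Y, hY⟩ := (eventually_atBot.1 (ih.eventually_ge_atTop 1))
    refine tendsto_atBot_atTop_of_deriv_le_neg (c := 2 * ν) (Y := Y)
      (by positivity) (fun y => (hasDerivAt_hermiteR ν y).const_mul _) fun y hy => ?_
    have := mul_le_mul_of_nonneg_left (hY y hy) (by positivity : 0 ≤ 2 * ν)
    rw [pow_succ (-1 : ℝ) (n + 1)]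
    linarith

/-- By the recurrence, the Hermite functions of large degree change sign at every point. -/
lemma exists_hermiteR_eq_zero (y M : ℝ) : ∃ ν, M < ν ∧ hermiteR ν y = 0 := by
  by_contra! hne
  have hc : Continuous fun ν => hermiteR ν y := by fun_prop
  have hsign : ∀ a b, M < a → M < b → 0 < hermiteR a y → 0 < hermiteR b y := by
    intro a b ha hb h
    by_contra! hb'
    obtain ⟨c, hc1, hc2⟩ := intermediate_value_uIcc (a := a) (b := b) hc.continuousOn
      (show (0 : ℝ) ∈ uIcc (hermiteR a y) (hermiteR b y) from mem_uIcc.2 (Or.inr ⟨hb', h.le⟩))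
    exact hne c ((lt_min ha hb).trans_le hc1.1) hc2
  have hsign' : ∀ a b, M < a → M < b → 0 < hermiteR a y * hermiteR b y := by
    intro a b ha hb
    rcases lt_or_gt_of_ne (hne a ha) with h | h
    · refine mul_pos_of_neg_of_neg h (lt_of_le_of_ne ?_ (hne b hb))
      by_contra! h'
      exact (lt_asymm h (hsign b a hb ha h'))
    · exact mul_pos h (hsign a b ha hb h)
  -- Large enough that `2y² < ν`, which makes the coefficient `4y² - 2(ν + 2)` of the twice-iterated
  -- recurrence negative.
  let ν := max M 0 + 2 * y ^ 2 + 1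
  have hM : M < ν := by
    have := le_max_left M 0
    simp only [ν]
    nlinarith [sq_nonneg y]
  have hν : 0 < ν ∧ 2 * y ^ 2 < ν := by
    have := le_max_right M 0
    refine ⟨?_, ?_⟩ <;> simp only [ν] <;> nlinarith [sq_nonneg y]
  have r1 := hermiteR_recurrence (ν + 2) y
  have r2 := hermiteR_recurrence (ν + 3) y
  rw [show ν + 2 - 1 = ν + 1 by ring, show ν + 2 - 2 = ν by ring] at r1
  rw [show ν + 3 - 1 = ν + 2 by ring, show ν + 3 - 2 = ν + 1 by ring] at r2
  have s1 := hsign' (ν + 2) (ν + 1) (by linarith) (by linarith)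
  have s2 := hsign' (ν + 3) (ν + 1) (by linarith) (by linarith)
  have s3 := hsign' ν (ν + 1) (by linarith) (by linarith)
  have s4 := hsign' (ν + 1) (ν + 1) (by linarith) (by linarith)
  set a := hermiteR ν y
  set b := hermiteR (ν + 1) y
  set c := hermiteR (ν + 2) y
  set d := hermiteR (ν + 3) y
  -- With no zeros beyond `M`, all values there have one sign. For `y ≤ 0` one step of the
  -- recurrence reverses it; for `y > 0` two steps do.
  rcases le_or_gt y 0 with hy | hy
  · rw [r1] at s1
    have : 2 * y * (b * b) ≤ 0 := by nlinarith
    nlinarith [mul_pos hν.1 s3]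
  · rw [r2, r1] at s2
    have e : (2 * y * (2 * y * b - 2 * (ν + 1) * a) - 2 * (ν + 2) * b) * b =
        (4 * y ^ 2 - 2 * (ν + 2)) * (b * b) - 4 * y * (ν + 1) * (a * b) := by ring
    have t1 : (4 * y ^ 2 - 2 * (ν + 2)) * (b * b) < 0 :=
      mul_neg_of_neg_of_pos (by linarith [hν.2]) s4
    have t2 : 0 < 4 * y * (ν + 1) * (a * b) := mul_pos (mul_pos (by linarith) (by linarith)) s3
    have s2' : 0 < (2 * y * (2 * y * b - 2 * (ν + 1) * a) - 2 * (ν + 2) * b) * b := by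
      convert s2 using 2
    linarith

/-! ### The decaying solution of the oscillator equation -/

/-- The solution of `u'' = (y² - (2ν + 1)) u` which decays at `+∞`. -/
noncomputable def oscSol (ν y : ℝ) : ℝ := Real.exp (-y ^ 2 / 2) * hermiteR ν y

/-- The derivative of `oscSol ν`. -/
noncomputable def oscSolDer (ν y : ℝ) : ℝ :=
  Real.exp (-y ^ 2 / 2) * (2 * ν * hermiteR (ν - 1) y - y * hermiteR ν y)

/-- The derivative of `oscSol` with respect to `ν`. -/
noncomputable def oscSolDeg (ν y : ℝ) : ℝ := Real.exp (-y ^ 2 / 2) * hermiteRDeg ν y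

/-- The derivative of `oscSolDer` with respect to `ν`. -/
noncomputable def oscSolDerDeg (ν y : ℝ) : ℝ :=
  Real.exp (-y ^ 2 / 2) *
    (2 * hermiteR (ν - 1) y + 2 * ν * hermiteRDeg (ν - 1) y - y * hermiteRDeg ν y)

@[fun_prop]
lemma continuous_oscSol_comp {X : Type*} [TopologicalSpace X] {f g : X → ℝ} (hf : Continuous f)
    (hg : Continuous g) : Continuous fun x => oscSol (f x) (g x) := by
  unfold oscSol; fun_prop

@[fun_prop]
lemma continuous_oscSolDer_comp {X : Type*} [TopologicalSpace X] {f g : X → ℝ} (hf : Continuous f)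
    (hg : Continuous g) : Continuous fun x => oscSolDer (f x) (g x) := by
  unfold oscSolDer; fun_prop

@[fun_prop]
lemma continuous_oscSolDeg_comp {X : Type*} [TopologicalSpace X] {f g : X → ℝ} (hf : Continuous f)
    (hg : Continuous g) : Continuous fun x => oscSolDeg (f x) (g x) := by
  unfold oscSolDeg; fun_prop

@[fun_prop]
lemma continuous_oscSolDerDeg_comp {X : Type*} [TopologicalSpace X] {f g : X → ℝ}
    (hf : Continuous f) (hg : Continuous g) : Continuous fun x => oscSolDerDeg (f x) (g x) := by
  unfold oscSolDerDeg; fun_prop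

lemma hasDerivAt_gauss (y : ℝ) :
    HasDerivAt (fun y : ℝ => Real.exp (-y ^ 2 / 2)) (-y * Real.exp (-y ^ 2 / 2)) y := by
  have h : HasDerivAt (fun y : ℝ => -y ^ 2 / 2) (-y) y := by
    refine (((hasDerivAt_id' y).fun_pow 2).fun_neg.div_const 2).congr_deriv ?_
    simp only [Nat.cast_ofNat, Nat.add_one_sub_one, pow_one]
    ring
  refine h.exp.congr_deriv (by ring)

lemma hasDerivAt_oscSol (ν y : ℝ) : HasDerivAt (oscSol ν) (oscSolDer ν y) y := by
  refine ((hasDerivAt_gauss y).mul (hasDerivAt_hermiteR ν y)).congr_deriv ?_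
  unfold oscSolDer
  ring

lemma hasDerivAt_oscSolDer (ν y : ℝ) :
    HasDerivAt (oscSolDer ν) ((y ^ 2 - (2 * ν + 1)) * oscSol ν y) y := by
  refine ((hasDerivAt_gauss y).mul (((hasDerivAt_hermiteR (ν - 1) y).const_mul (2 * ν)).fun_sub
    ((hasDerivAt_id' y).fun_mul (hasDerivAt_hermiteR ν y)))).congr_deriv ?_
  have r := hermiteR_recurrence ν y
  rw [show ν - 1 - 1 = ν - 2 by ring]
  unfold oscSol
  linear_combination (2 * ν * Real.exp (-y ^ 2 / 2)) * r

lemma hasDerivAt_oscSol_degree (ν y : ℝ) :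
    HasDerivAt (fun ν => oscSol ν y) (oscSolDeg ν y) ν :=
  (hasDerivAt_hermiteR_degree ν y).const_mul _

lemma hasDerivAt_oscSolDer_degree (ν y : ℝ) :
    HasDerivAt (fun ν => oscSolDer ν y) (oscSolDerDeg ν y) ν := by
  have h1 := (hasDerivAt_hermiteR_degree (ν - 1) y).comp_sub_const ν 1
  have h3 : HasDerivAt (fun ν : ℝ => 2 * ν) 2 ν := by
    simpa using (hasDerivAt_id' ν).const_mul 2
  exact ((h3.fun_mul h1).fun_sub
    ((hasDerivAt_hermiteR_degree ν y).const_mul y)).const_mul _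

lemma oscSol_eq_zero_iff {ν y : ℝ} : oscSol ν y = 0 ↔ hermiteR ν y = 0 := by
  unfold oscSol
  rw [mul_eq_zero, or_iff_right (Real.exp_ne_zero _)]

lemma oscSolDer_ne_zero {ν y : ℝ} (h : oscSol ν y = 0) : oscSolDer ν y ≠ 0 := by
  rw [oscSol_eq_zero_iff] at h
  have h1 := hermiteR_ne_zero_of_eq_zero h
  unfold oscSolDer
  rw [h, mul_zero, sub_zero, mul_assoc]
  exact mul_ne_zero (Real.exp_ne_zero _) (mul_ne_zero two_ne_zero h1)

lemma oscSol_sq_add_pos (ν y : ℝ) : 0 < oscSol ν y ^ 2 + oscSolDer ν y ^ 2 := by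
  by_cases h : oscSol ν y = 0
  · have := oscSolDer_ne_zero h
    positivity
  · positivity

lemma exists_oscSol_ne_zero (ν y : ℝ) : ∃ x, y < x ∧ oscSol ν x ≠ 0 := by
  by_contra! h
  have h1 : HasDerivAt (oscSol ν) 0 (y + 1) := by
    refine (hasDerivAt_const (y + 1) (0 : ℝ)).congr_of_eventuallyEq ?_
    filter_upwards [Ioi_mem_nhds (lt_add_one y)] with x hx
    exact h x hx
  exact oscSolDer_ne_zero (h (y + 1) (lt_add_one y)) ((hasDerivAt_oscSol ν (y + 1)).unique h1)

lemma polyGrowth_oscSolDer_aux (ν : ℝ) :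
    PolyGrowth fun y => 2 * ν * hermiteR (ν - 1) y - y * hermiteR ν y :=
  ((polyGrowth_const _).mul (polyGrowth_hermiteR _)).sub (polyGrowth_id.mul (polyGrowth_hermiteR _))

lemma oscSol_isBigO (ν : ℝ) : oscSol ν =O[atTop] fun y => Real.exp (-1 * y) :=
  (polyGrowth_hermiteR ν).gauss_isBigO

lemma oscSol_tendsto (ν : ℝ) : Tendsto (oscSol ν) atTop (𝓝 0) :=
  (polyGrowth_hermiteR ν).gauss_tendsto

lemma oscSolDer_tendsto (ν : ℝ) : Tendsto (oscSolDer ν) atTop (𝓝 0) :=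
  (polyGrowth_oscSolDer_aux ν).gauss_tendsto

lemma oscSolDeg_tendsto (ν : ℝ) : Tendsto (oscSolDeg ν) atTop (𝓝 0) :=
  (polyGrowth_hermiteRDeg ν).gauss_tendsto

lemma oscSolDerDeg_tendsto (ν : ℝ) : Tendsto (oscSolDerDeg ν) atTop (𝓝 0) :=
  ((((polyGrowth_const _).mul (polyGrowth_hermiteR _)).add
    ((polyGrowth_const _).mul (polyGrowth_hermiteRDeg _))).sub
    (polyGrowth_id.mul (polyGrowth_hermiteRDeg _))).gauss_tendsto

/-- A function decreasing to `0` is nonnegative; if it were not positive at `y`, it would vanish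
identically beyond `y`, along with its derivative. This yields both the sign of `u u'` and the
positivity of the Wronskian. -/
lemma pos_of_hasDerivAt_nonpos_of_tendsto {f f' : ℝ → ℝ} {y : ℝ}
    (hf : ∀ x, HasDerivAt f (f' x) x) (h : ∀ x, y < x → f' x ≤ 0) (hne : ∃ x, y < x ∧ f' x ≠ 0)
    (ht : Tendsto f atTop (𝓝 0)) : 0 < f y := by
  have ha : AntitoneOn f (Ici y) := by
    refine antitoneOn_of_deriv_nonpos (convex_Ici y)
      (fun y _ => (hf y).continuousAt.continuousWithinAt)
      (fun y _ => (hf y).differentiableAt.differentiableWithinAt) fun x hx => ?_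
    rw [interior_Ici] at hx
    rw [(hf x).deriv]
    exact h x hx
  have h0 : ∀ x, y ≤ x → 0 ≤ f x := fun x hx => by
    refine le_of_tendsto ht ?_
    filter_upwards [eventually_ge_atTop x] with z hz
    exact ha hx (hx.trans hz) hz
  by_contra! hy
  obtain ⟨x, hx, hx'⟩ := hne
  have h1 : HasDerivAt f 0 x := by
    refine (hasDerivAt_const x (0 : ℝ)).congr_of_eventuallyEq ?_
    filter_upwards [Ioi_mem_nhds hx] with z hz
    have hz : y ≤ z := le_of_lt hz
    exact le_antisymm ((ha (mem_Ici.2 le_rfl) hz hz).trans hy) (h0 z hz)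
  exact hx' ((hf x).unique h1)

/-- The solution and its derivative have opposite signs where the potential exceeds the energy. -/
lemma oscSol_mul_oscSolDer_neg {ν y : ℝ} (h : ∀ x, y < x → 2 * ν + 1 ≤ x ^ 2) :
    oscSol ν y * oscSolDer ν y < 0 := by
  -- Here `(u u')' = u'² + (x² - (2ν + 1)) u²`, and `u u'` tends to `0` at `+∞`.
  have hd : ∀ x, HasDerivAt (fun x => -(oscSol ν x * oscSolDer ν x))
      (-(oscSolDer ν x ^ 2 + (x ^ 2 - (2 * ν + 1)) * oscSol ν x ^ 2)) x := fun x => by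
    refine ((hasDerivAt_oscSol ν x).fun_mul (hasDerivAt_oscSolDer ν x)).fun_neg.congr_deriv ?_
    ring
  have := pos_of_hasDerivAt_nonpos_of_tendsto (y := y) hd (fun x hx => ?_) ?_ ?_
  · linarith
  · have := mul_nonneg (sub_nonneg.2 (h x hx)) (sq_nonneg (oscSol ν x))
    nlinarith [sq_nonneg (oscSolDer ν x)]
  · obtain ⟨x, hx, hx'⟩ := exists_oscSol_ne_zero ν (max y (|2 * ν + 1| + 1))
    have h1 := (le_max_left y _).trans_lt hx
    have h2 := (le_max_right y (|2 * ν + 1| + 1)).trans_lt hx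
    refine ⟨x, h1, ?_⟩
    have h3 : 2 * ν + 1 < x ^ 2 := by nlinarith [abs_nonneg (2 * ν + 1), le_abs_self (2 * ν + 1)]
    have h4 : 0 < (x ^ 2 - (2 * ν + 1)) * oscSol ν x ^ 2 :=
      mul_pos (by linarith) (by positivity)
    have := sq_nonneg (oscSolDer ν x)
    intro h5
    linarith
  · simpa using ((oscSol_tendsto ν).mul (oscSolDer_tendsto ν)).neg

/-! ### The Wronskian and the polar angle in the degree -/

/-- The Wronskian of `oscSol` and its derivative with respect to `ν`. -/
noncomputable def oscWronskian (ν y : ℝ) : ℝ :=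
  oscSol ν y * oscSolDerDeg ν y - oscSolDer ν y * oscSolDeg ν y

/-- Differentiating the oscillator equation in `ν` gives `(∂_ν u)'' = (y² - (2ν + 1)) ∂_ν u - 2u`,
so the potential terms cancel in the Wronskian. The computation verifies this through the recurrence
and its derivative in `ν`. -/
lemma hasDerivAt_oscWronskian (ν y : ℝ) :
    HasDerivAt (oscWronskian ν) (-(2 * oscSol ν y ^ 2)) y := by
  have d1 := hasDerivAt_hermiteR ν y
  have d2 := hasDerivAt_hermiteR (ν - 1) y
  have d3 := hasDerivAt_hermiteRDeg ν y
  have d4 := hasDerivAt_hermiteRDeg (ν - 1) y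
  have d5 : HasDerivAt (fun y : ℝ => Real.exp (-y ^ 2 / 2) ^ 2)
      (-2 * y * Real.exp (-y ^ 2 / 2) ^ 2) y := by
    refine ((hasDerivAt_gauss y).fun_pow 2).congr_deriv ?_
    simp only [Nat.cast_ofNat, Nat.add_one_sub_one, pow_one]
    ring
  have e : oscWronskian ν = fun y => Real.exp (-y ^ 2 / 2) ^ 2 *
      (hermiteR ν y * (2 * hermiteR (ν - 1) y + 2 * ν * hermiteRDeg (ν - 1) y)
        - 2 * ν * hermiteR (ν - 1) y * hermiteRDeg ν y) := by
    funext y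
    unfold oscWronskian oscSol oscSolDer oscSolDeg oscSolDerDeg
    ring
  rw [e]
  refine (d5.fun_mul ((d1.fun_mul ((d2.const_mul 2).fun_add (d4.const_mul (2 * ν)))).fun_sub
    ((d2.const_mul (2 * ν)).fun_mul d3))).congr_deriv ?_
  have r1 := hermiteR_recurrence ν y
  have r2 := hermiteRDeg_recurrence ν y
  rw [show ν - 1 - 1 = ν - 2 by ring]
  unfold oscSol
  generalize Real.exp (-y ^ 2 / 2) = E at *
  generalize hermiteR ν y = h at *
  generalize hermiteR (ν - 1) y = h1 at *
  generalize hermiteR (ν - 2) y = h2 at *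
  generalize hermiteRDeg ν y = d at *
  generalize hermiteRDeg (ν - 1) y = k1 at *
  generalize hermiteRDeg (ν - 2) y = k2 at *
  linear_combination E ^ 2 * (2 * h - 2 * ν * d) * r1 + E ^ 2 * (2 * ν * h) * r2

lemma oscWronskian_pos (ν y : ℝ) : 0 < oscWronskian ν y := by
  refine pos_of_hasDerivAt_nonpos_of_tendsto (hasDerivAt_oscWronskian ν) (fun x _ => ?_) ?_ ?_
  · have := sq_nonneg (oscSol ν x)
    linarith
  · obtain ⟨x, hx, hx'⟩ := exists_oscSol_ne_zero ν y
    exact ⟨x, hx, neg_ne_zero.2 (mul_ne_zero two_ne_zero (pow_ne_zero 2 hx'))⟩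
  · simpa using! ((oscSol_tendsto ν).mul (oscSolDerDeg_tendsto ν)).sub
      ((oscSolDer_tendsto ν).mul (oscSolDeg_tendsto ν))

/-- The polar angle of `(oscSol ν y, oscSolDer ν y)`, normalised at `ν = -1`. -/
noncomputable def oscAngle (ν y : ℝ) : ℝ :=
  Real.arctan (oscSolDer (-1) y / oscSol (-1) y) +
    ∫ s in (-1 : ℝ)..ν, oscWronskian s y / (oscSol s y ^ 2 + oscSolDer s y ^ 2)

lemma continuous_oscAngle_integrand : Continuous fun p : ℝ × ℝ =>
    oscWronskian p.2 p.1 / (oscSol p.2 p.1 ^ 2 + oscSolDer p.2 p.1 ^ 2) := by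
  refine Continuous.div ?_ (by fun_prop) fun p => (oscSol_sq_add_pos _ _).ne'
  unfold oscWronskian
  fun_prop

lemma oscSol_neg_one_pos (y : ℝ) : 0 < oscSol (-1) y :=
  mul_pos (Real.exp_pos _) (hermiteR_pos (by norm_num) y)

lemma continuous_oscAngle (ν : ℝ) : Continuous (oscAngle ν) := by
  refine Continuous.add ?_ ?_
  · refine Real.continuous_arctan.comp (Continuous.div (by fun_prop) (by fun_prop) fun y => ?_)
    exact (oscSol_neg_one_pos y).ne'
  · exact intervalIntegral.continuous_parametric_intervalIntegral_of_continuous'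
      (f := fun y s => oscWronskian s y / (oscSol s y ^ 2 + oscSolDer s y ^ 2))
      continuous_oscAngle_integrand _ _

lemma hasDerivAt_oscAngle (ν y : ℝ) : HasDerivAt (fun ν => oscAngle ν y)
    (oscWronskian ν y / (oscSol ν y ^ 2 + oscSolDer ν y ^ 2)) ν := by
  have hc : Continuous fun s => oscWronskian s y / (oscSol s y ^ 2 + oscSolDer s y ^ 2) :=
    Continuous.comp (f := fun s : ℝ => (y, s)) (g := fun p : ℝ × ℝ =>
      oscWronskian p.2 p.1 / (oscSol p.2 p.1 ^ 2 + oscSolDer p.2 p.1 ^ 2))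
      continuous_oscAngle_integrand (by fun_prop)
  exact (intervalIntegral.integral_hasDerivAt_right (hc.intervalIntegrable _ _)
    (hc.stronglyMeasurableAtFilter _ _) hc.continuousAt).const_add _

lemma strictMono_oscAngle (y : ℝ) : StrictMono fun ν => oscAngle ν y := by
  refine strictMono_of_deriv_pos fun ν => ?_
  rw [(hasDerivAt_oscAngle ν y).deriv]
  exact div_pos (oscWronskian_pos ν y) (oscSol_sq_add_pos ν y)

lemma continuous_oscAngle_degree (y : ℝ) : Continuous fun ν => oscAngle ν y :=
  continuous_iff_continuousAt.2 fun ν => (hasDerivAt_oscAngle ν y).continuousAt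

lemma oscAngle_neg_one (y : ℝ) :
    oscAngle (-1) y = Real.arctan (oscSolDer (-1) y / oscSol (-1) y) := by
  simp [oscAngle]

/-- The left side divided by the right is the cosine of the discrepancy between `oscAngle` and the
true polar angle. Its `ν`-derivative is zero, and at `ν = -1`, where `u > 0` makes the arctangent
the right branch, it equals `1`. -/
lemma oscSol_mul_cos_add (ν y : ℝ) :
    oscSol ν y * Real.cos (oscAngle ν y) + oscSolDer ν y * Real.sin (oscAngle ν y) =
      √(oscSol ν y ^ 2 + oscSolDer ν y ^ 2) := by
  have hd : ∀ ν, HasDerivAt (fun ν => (oscSol ν y * Real.cos (oscAngle ν y) +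
      oscSolDer ν y * Real.sin (oscAngle ν y)) / √(oscSol ν y ^ 2 + oscSolDer ν y ^ 2)) 0 ν := by
    intro ν
    have hρ := oscSol_sq_add_pos ν y
    have d1 := hasDerivAt_oscSol_degree ν y
    have d2 := hasDerivAt_oscSolDer_degree ν y
    have d3 := hasDerivAt_oscAngle ν y
    have hs := Real.sqrt_pos.2 hρ
    have hs2 := Real.sq_sqrt hρ.le
    refine (((d1.fun_mul d3.cos).fun_add (d2.fun_mul d3.sin)).fun_div
      (((d1.fun_pow 2).fun_add (d2.fun_pow 2)).sqrt hρ.ne') hs.ne').congr_deriv ?_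
    rw [div_eq_zero_iff]
    left
    unfold oscWronskian
    generalize √(oscSol ν y ^ 2 + oscSolDer ν y ^ 2) = S at *
    rw [← hs2]
    generalize oscSol ν y = a at *
    generalize oscSolDer ν y = b at *
    generalize Real.cos (oscAngle ν y) = c at *
    generalize Real.sin (oscAngle ν y) = s at *
    generalize oscSolDeg ν y = a' at *
    generalize oscSolDerDeg ν y = b' at *
    simp only [Nat.cast_ofNat, Nat.add_one_sub_one, pow_one]
    field_simp
    linear_combination (c * a' + s * b') * hs2
  have hc := is_const_of_deriv_eq_zero (fun ν => (hd ν).differentiableAt)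
    (fun ν => (hd ν).deriv) ν (-1)
  have h1 : (oscSol (-1) y * Real.cos (oscAngle (-1) y) +
      oscSolDer (-1) y * Real.sin (oscAngle (-1) y)) /
      √(oscSol (-1) y ^ 2 + oscSolDer (-1) y ^ 2) = 1 := by
    have hp := oscSol_neg_one_pos y
    rw [oscAngle_neg_one, Real.cos_arctan, Real.sin_arctan]
    generalize oscSol (-1) y = a at *
    generalize oscSolDer (-1) y = b at *
    have e : √(a ^ 2 + b ^ 2) = a * √(1 + (b / a) ^ 2) := by
      rw [← Real.sqrt_sq hp.le, ← Real.sqrt_mul (sq_nonneg _), Real.sqrt_sq hp.le]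
      congr 1
      field_simp
    have hpos : 0 < 1 + (b / a) ^ 2 := by positivity
    have hs2 := Real.sq_sqrt hpos.le
    have hs := Real.sqrt_pos.2 hpos
    rw [e]
    generalize √(1 + (b / a) ^ 2) = S at *
    field_simp at hs2 ⊢
    linarith
  have hs := Real.sqrt_pos.2 (oscSol_sq_add_pos ν y)
  rw [h1, div_eq_one_iff_eq hs.ne'] at hc
  exact hc

/-- Equality in the Cauchy–Schwarz inequality: the component `a * s - b * c` orthogonal to the
direction of the angle must vanish. -/
lemma oscSol_polar (ν y : ℝ) :
    oscSol ν y = √(oscSol ν y ^ 2 + oscSolDer ν y ^ 2) * Real.cos (oscAngle ν y) ∧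
    oscSolDer ν y = √(oscSol ν y ^ 2 + oscSolDer ν y ^ 2) * Real.sin (oscAngle ν y) := by
  have h := oscSol_mul_cos_add ν y
  have hs2 := Real.sq_sqrt (oscSol_sq_add_pos ν y).le
  have hcs := Real.sin_sq_add_cos_sq (oscAngle ν y)
  generalize √(oscSol ν y ^ 2 + oscSolDer ν y ^ 2) = S at *
  generalize oscSol ν y = a at *
  generalize oscSolDer ν y = b at *
  generalize Real.cos (oscAngle ν y) = c at *
  generalize Real.sin (oscAngle ν y) = s at *
  have hB : a * s - b * c = 0 := by
    have : (a * s - b * c) ^ 2 = 0 := by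
      have : (a * s - b * c) ^ 2 = (a ^ 2 + b ^ 2) * (s ^ 2 + c ^ 2) - (a * c + b * s) ^ 2 := by
        ring
      rw [this, hcs, h, hs2]
      ring
    exact pow_eq_zero_iff two_ne_zero |>.1 this
  constructor
  · linear_combination -a * hcs + c * h + s * hB
  · linear_combination -b * hcs + s * h - c * hB

lemma oscSol_eq_zero_iff_cos {ν y : ℝ} : oscSol ν y = 0 ↔ Real.cos (oscAngle ν y) = 0 := by
  have hs := Real.sqrt_pos.2 (oscSol_sq_add_pos ν y)
  conv_lhs => rw [(oscSol_polar ν y).1, mul_eq_zero, or_iff_right hs.ne']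

lemma oscSolDer_eq_zero_iff_sin {ν y : ℝ} : oscSolDer ν y = 0 ↔ Real.sin (oscAngle ν y) = 0 := by
  have hs := Real.sqrt_pos.2 (oscSol_sq_add_pos ν y)
  conv_lhs => rw [(oscSol_polar ν y).2, mul_eq_zero, or_iff_right hs.ne']

lemma oscAngle_neg_one_mem (y : ℝ) : oscAngle (-1) y ∈ Ioo (-(Real.pi / 2)) 0 := by
  rw [oscAngle_neg_one]
  refine ⟨Real.neg_pi_div_two_lt_arctan _, ?_⟩
  rw [Real.arctan_lt_zero, div_neg_iff]
  have h1 := oscSol_neg_one_pos y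
  have h2 := oscSol_mul_oscSolDer_neg (ν := -1) (y := y) fun x _ => by nlinarith [sq_nonneg x]
  exact Or.inr ⟨by nlinarith, h1⟩

lemma neg_half_lt_of_mul_eq_zero {ν y : ℝ} (h : oscSol ν y * oscSolDer ν y = 0) :
    0 < 2 * ν + 1 := by
  by_contra! h'
  have := oscSol_mul_oscSolDer_neg (ν := ν) (y := y) fun x _ => h'.trans (sq_nonneg x)
  linarith

lemma sq_lt_of_mul_eq_zero {ν y : ℝ} (hy : 0 ≤ y) (h : oscSol ν y * oscSolDer ν y = 0) :
    y ^ 2 < 2 * ν + 1 := by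
  by_contra! h'
  have := oscSol_mul_oscSolDer_neg (ν := ν) (y := y) fun x hx =>
    h'.trans (pow_le_pow_left₀ hy hx.le 2)
  linarith

/-- A zero forces `ν > -1/2`, so by monotonicity the angle exceeds its value at `ν = -1`, itself
above `-π/2`. This excludes negative multiples of `π`. -/
lemma oscAngle_of_oscSol_eq_zero {ν y : ℝ} (h : oscSol ν y = 0) :
    ∃ n : ℕ, oscAngle ν y = Real.pi / 2 + n * Real.pi := by
  obtain ⟨k, hk⟩ := Real.cos_eq_zero_iff.1 (oscSol_eq_zero_iff_cos.1 h)
  have h1 : 0 < 2 * ν + 1 := neg_half_lt_of_mul_eq_zero (y := y) (by rw [h, zero_mul])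
  have h2 : oscAngle (-1) y < oscAngle ν y := strictMono_oscAngle y (by linarith)
  have h3 := (oscAngle_neg_one_mem y).1
  have h4 : (-1 : ℝ) < k := by
    rw [hk] at h2
    have := Real.pi_pos
    by_contra! h
    nlinarith
  have h5 : (-1 : ℤ) < k := by exact_mod_cast h4
  obtain ⟨n, rfl⟩ := Int.eq_ofNat_of_zero_le (by omega : 0 ≤ k)
  refine ⟨n, ?_⟩
  rw [hk]
  push_cast
  ring

lemma oscAngle_of_oscSolDer_eq_zero {ν y : ℝ} (h : oscSolDer ν y = 0) :
    ∃ n : ℕ, oscAngle ν y = n * Real.pi := by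
  obtain ⟨k, hk⟩ := Real.sin_eq_zero_iff.1 (oscSolDer_eq_zero_iff_sin.1 h)
  have h1 : 0 < 2 * ν + 1 := neg_half_lt_of_mul_eq_zero (y := y) (by rw [h, mul_zero])
  have h2 : oscAngle (-1) y < oscAngle ν y := strictMono_oscAngle y (by linarith)
  have h3 := (oscAngle_neg_one_mem y).1
  have h4 : (-1 : ℝ) < k := by
    rw [← hk] at h2
    have := Real.pi_pos
    by_contra! h
    nlinarith
  have h5 : (-1 : ℤ) < k := by exact_mod_cast h4
  obtain ⟨n, rfl⟩ := Int.eq_ofNat_of_zero_le (by omega : 0 ≤ k)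
  exact ⟨n, hk.symm⟩

/-- Zeros occur at arbitrarily large degrees, and each later one puts the angle at a strictly higher
level `π/2 + mπ`. -/
lemma exists_le_oscAngle (y : ℝ) (n : ℕ) : ∃ ν, Real.pi / 2 + n * Real.pi ≤ oscAngle ν y := by
  induction n with
  | zero =>
    obtain ⟨ν, _, h⟩ := exists_hermiteR_eq_zero y 0
    obtain ⟨m, hm⟩ := oscAngle_of_oscSol_eq_zero (oscSol_eq_zero_iff.2 h)
    refine ⟨ν, ?_⟩
    rw [hm]
    have := Real.pi_pos
    simp only [Nat.cast_zero, zero_mul, add_zero, le_add_iff_nonneg_right]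
    positivity
  | succ n ih =>
    obtain ⟨ν, hν⟩ := ih
    obtain ⟨ν', h1, h⟩ := exists_hermiteR_eq_zero y ν
    obtain ⟨m, hm⟩ := oscAngle_of_oscSol_eq_zero (oscSol_eq_zero_iff.2 h)
    refine ⟨ν', ?_⟩
    have h2 : oscAngle ν y < oscAngle ν' y := strictMono_oscAngle y h1
    rw [hm] at h2 ⊢
    have h3 : n * Real.pi < m * Real.pi := by linarith
    have h4 : n < m := by exact_mod_cast lt_of_mul_lt_mul_right h3 Real.pi_pos.le
    have h5 : ((n + 1 : ℕ) : ℝ) ≤ m := by exact_mod_cast h4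
    have := mul_le_mul_of_nonneg_right h5 Real.pi_pos.le
    linarith

lemma exists_oscAngle_eq {c : ℝ} (hc : 0 ≤ c) (y : ℝ) : ∃ ν, oscAngle ν y = c := by
  obtain ⟨n, hn⟩ := exists_nat_ge (c / Real.pi)
  rw [div_le_iff₀ Real.pi_pos] at hn
  obtain ⟨ν, hν⟩ := exists_le_oscAngle y n
  have h1 := (oscAngle_neg_one_mem y).2
  exact mem_range_of_exists_le_of_exists_ge (continuous_oscAngle_degree y) ⟨-1, by linarith⟩
    ⟨ν, by linarith [Real.pi_pos]⟩

/-! ### Level curves of the angle: Dirichlet and Neumann degrees -/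

/-- The degree `ν` at which the angle at the point `y` equals `c`. -/
noncomputable def oscLevel (c y : ℝ) : ℝ := Classical.epsilon fun ν => oscAngle ν y = c

lemma oscAngle_oscLevel {c : ℝ} (hc : 0 ≤ c) (y : ℝ) : oscAngle (oscLevel c y) y = c :=
  Classical.epsilon_spec (exists_oscAngle_eq hc y)

lemma oscLevel_lt_iff {c : ℝ} (hc : 0 ≤ c) {ν y : ℝ} : oscLevel c y < ν ↔ c < oscAngle ν y := by
  rw [← (strictMono_oscAngle y).lt_iff_lt, oscAngle_oscLevel hc]

lemma lt_oscLevel_iff {c : ℝ} (hc : 0 ≤ c) {ν y : ℝ} : ν < oscLevel c y ↔ oscAngle ν y < c := by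
  rw [← (strictMono_oscAngle y).lt_iff_lt, oscAngle_oscLevel hc]

lemma eq_oscLevel_iff {c : ℝ} (hc : 0 ≤ c) {ν y : ℝ} : ν = oscLevel c y ↔ oscAngle ν y = c := by
  rw [← (strictMono_oscAngle y).injective.eq_iff, oscAngle_oscLevel hc]

lemma oscLevel_lt_oscLevel {c d : ℝ} (hc : 0 ≤ c) (hcd : c < d) (y : ℝ) :
    oscLevel c y < oscLevel d y := by
  rw [oscLevel_lt_iff hc, oscAngle_oscLevel (hc.trans hcd.le)]
  exact hcd

/-- Strict bounds on the level translate into strict bounds on the angle at a fixed degree, which is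
continuous in `y`. -/
lemma continuous_oscLevel {c : ℝ} (hc : 0 ≤ c) : Continuous (oscLevel c) := by
  refine continuous_iff_continuousAt.2 fun y => tendsto_order.2 ⟨fun a ha => ?_, fun a ha => ?_⟩
  · simp only [lt_oscLevel_iff hc] at ha ⊢
    exact (continuous_oscAngle a).continuousAt.eventually_lt_const ha
  · simp only [oscLevel_lt_iff hc] at ha ⊢
    exact (continuous_oscAngle a).continuousAt.eventually_const_lt ha

/-- The `n`-th zero of `ν ↦ oscSol ν y`. -/
noncomputable def dirichletDeg (n : ℕ) (y : ℝ) : ℝ := oscLevel (Real.pi / 2 + n * Real.pi) y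

/-- The `n`-th zero of `ν ↦ oscSolDer ν y`. -/
noncomputable def neumannDeg (n : ℕ) (y : ℝ) : ℝ := oscLevel (n * Real.pi) y

lemma dirichlet_level_nonneg (n : ℕ) : 0 ≤ Real.pi / 2 + n * Real.pi := by
  have := Real.pi_pos
  positivity

lemma neumann_level_nonneg (n : ℕ) : 0 ≤ n * Real.pi := by
  have := Real.pi_pos
  positivity

lemma oscSol_dirichletDeg (n : ℕ) (y : ℝ) : oscSol (dirichletDeg n y) y = 0 := by
  rw [oscSol_eq_zero_iff_cos, dirichletDeg, oscAngle_oscLevel (dirichlet_level_nonneg n),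
    Real.cos_add_nat_mul_pi, Real.cos_pi_div_two, mul_zero]

lemma oscSolDer_neumannDeg (n : ℕ) (y : ℝ) : oscSolDer (neumannDeg n y) y = 0 := by
  rw [oscSolDer_eq_zero_iff_sin, neumannDeg, oscAngle_oscLevel (neumann_level_nonneg n),
    Real.sin_nat_mul_pi]

lemma oscSol_eq_zero_iff_dirichletDeg {ν y : ℝ} :
    oscSol ν y = 0 ↔ ∃ n, dirichletDeg n y = ν := by
  refine ⟨fun h => ?_, ?_⟩
  · obtain ⟨n, hn⟩ := oscAngle_of_oscSol_eq_zero h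
    exact ⟨n, ((eq_oscLevel_iff (dirichlet_level_nonneg n)).2 hn).symm⟩
  · rintro ⟨n, rfl⟩
    exact oscSol_dirichletDeg n y

lemma oscSolDer_eq_zero_iff_neumannDeg {ν y : ℝ} :
    oscSolDer ν y = 0 ↔ ∃ n, neumannDeg n y = ν := by
  refine ⟨fun h => ?_, ?_⟩
  · obtain ⟨n, hn⟩ := oscAngle_of_oscSolDer_eq_zero h
    exact ⟨n, ((eq_oscLevel_iff (neumann_level_nonneg n)).2 hn).symm⟩
  · rintro ⟨n, rfl⟩
    exact oscSolDer_neumannDeg n y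

lemma strictMono_dirichletDeg (y : ℝ) : StrictMono fun n => dirichletDeg n y := by
  intro m n h
  refine oscLevel_lt_oscLevel (dirichlet_level_nonneg m) ?_ y
  have := Real.pi_pos
  gcongr

lemma strictMono_neumannDeg (y : ℝ) : StrictMono fun n => neumannDeg n y := by
  intro m n h
  refine oscLevel_lt_oscLevel (neumann_level_nonneg m) ?_ y
  have := Real.pi_pos
  gcongr

lemma neumannDeg_lt_dirichletDeg (n : ℕ) (y : ℝ) : neumannDeg n y < dirichletDeg n y :=
  oscLevel_lt_oscLevel (neumann_level_nonneg n) (by linarith [Real.pi_pos]) y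

lemma dirichletDeg_lt_neumannDeg (n : ℕ) (y : ℝ) : dirichletDeg n y < neumannDeg (n + 1) y :=
  oscLevel_lt_oscLevel (dirichlet_level_nonneg n) (by push_cast; linarith [Real.pi_pos]) y

/-- Both sides are strictly increasing sequences with the same range, namely the degrees with
`H_ν(0) = 0`. -/
lemma dirichletDeg_zero (n : ℕ) : dirichletDeg n 0 = 2 * n + 1 := by
  have h1 : StrictMono fun n : ℕ => (2 * n + 1 : ℝ) := by
    intro m n h
    have : (m : ℝ) < n := by exact_mod_cast h
    simp only
    linarith
  have h2 : range (fun n => dirichletDeg n 0) = range fun n : ℕ => (2 * n + 1 : ℝ) := by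
    ext ν
    rw [mem_range, ← oscSol_eq_zero_iff_dirichletDeg, oscSol_eq_zero_iff,
      hermiteR_at_zero_eq_zero_iff]
    exact ⟨fun ⟨n, h⟩ => ⟨n, h.symm⟩, fun ⟨n, h⟩ => ⟨n, h.symm⟩⟩
  exact congrFun (((strictMono_dirichletDeg 0).range_inj h1).1 h2) n

lemma neumannDeg_zero (n : ℕ) : neumannDeg n 0 = 2 * n := by
  have h1 : StrictMono fun n : ℕ => (2 * n : ℝ) := by
    intro m n h
    have : (m : ℝ) < n := by exact_mod_cast h
    simp only
    linarith
  have h2 : range (fun n => neumannDeg n 0) = range fun n : ℕ => (2 * n : ℝ) := by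
    ext ν
    rw [mem_range, ← oscSolDer_eq_zero_iff_neumannDeg]
    have : oscSolDer ν 0 = 0 ↔ ν = 0 ∨ hermiteR (ν - 1) 0 = 0 := by
      simp [oscSolDer]
    rw [this, hermiteR_at_zero_eq_zero_iff, mem_range]
    constructor
    · rintro (rfl | ⟨n, h⟩)
      · exact ⟨0, by simp⟩
      · exact ⟨n + 1, by push_cast; linarith⟩
    · rintro ⟨n, rfl⟩
      cases n with
      | zero => left; simp
      | succ n => right; exact ⟨n, by push_cast; ring⟩
  exact congrFun (((strictMono_neumannDeg 0).range_inj h1).1 h2) n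

lemma dirichletDeg_bound (n : ℕ) {y : ℝ} (hy : 0 ≤ y) : y ^ 2 < 2 * dirichletDeg n y + 1 :=
  sq_lt_of_mul_eq_zero hy (by rw [oscSol_dirichletDeg, zero_mul])

lemma neumannDeg_bound (n : ℕ) {y : ℝ} (hy : 0 ≤ y) : y ^ 2 < 2 * neumannDeg n y + 1 :=
  sq_lt_of_mul_eq_zero hy (by rw [oscSolDer_neumannDeg, mul_zero])

lemma neumannDeg_pos (n : ℕ) (y : ℝ) : 0 < 2 * neumannDeg n y + 1 :=
  neg_half_lt_of_mul_eq_zero (y := y) (by rw [oscSolDer_neumannDeg, mul_zero])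

lemma tendsto_atTop_of_sq_lt {f : ℝ → ℝ} (h : ∀ y, 0 ≤ y → y ^ 2 < f y) :
    Tendsto f atTop atTop := by
  refine tendsto_atTop_mono' _ ?_ tendsto_id
  filter_upwards [eventually_ge_atTop 1] with y hy
  have := h y (by linarith)
  simp only [id]
  nlinarith

lemma continuous_dirichletDeg (n : ℕ) : Continuous (dirichletDeg n) :=
  continuous_oscLevel (dirichlet_level_nonneg n)

lemma continuous_neumannDeg (n : ℕ) : Continuous (neumannDeg n) :=
  continuous_oscLevel (neumann_level_nonneg n)

/-! ### Behaviour of the level curves as `y → -∞` -/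

/-- Otherwise the Hermite polynomial of degree `n` would have `n + 1` zeros. -/
lemma lt_dirichletDeg (n : ℕ) (y : ℝ) : n < dirichletDeg n y := by
  by_contra! h
  obtain ⟨p, hp, hp'⟩ := exists_polynomial_hermiteR n
  have hp0 : p ≠ 0 := by
    rintro rfl
    obtain ⟨x, _, hx⟩ := exists_oscSol_ne_zero n 0
    rw [ne_eq, oscSol_eq_zero_iff, hp'] at hx
    simp at hx
  -- Each of the curves `0, …, n` is at most `n` at `y` and tends to `+∞`, so it crosses the value
  -- `n`; distinct curves are disjoint, so the crossing points are distinct.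
  have hx : ∀ k : Fin (n + 1), ∃ x, dirichletDeg k x = n := by
    intro k
    have h1 : dirichletDeg k y ≤ n :=
      ((strictMono_dirichletDeg y).monotone (Nat.lt_succ_iff.1 k.2)).trans h
    have h2 : ∀ᶠ x in atTop, n ≤ dirichletDeg k x := by
      have := tendsto_atTop_of_sq_lt fun y hy => dirichletDeg_bound k hy
      filter_upwards [this.eventually_ge_atTop (2 * n + 1)] with x hx
      linarith
    obtain ⟨z, hz⟩ := h2.exists
    exact mem_range_of_exists_le_of_exists_ge (continuous_dirichletDeg k) ⟨y, h1⟩ ⟨z, hz⟩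
  choose x hx using hx
  have hinj : Function.Injective x := by
    intro j k hjk
    have : dirichletDeg j (x j) = dirichletDeg k (x j) := by rw [hx j, hjk, hx k]
    exact Fin.ext ((strictMono_dirichletDeg (x j)).injective this)
  have hroot : ∀ k, x k ∈ p.roots.toFinset := by
    intro k
    rw [Multiset.mem_toFinset, Polynomial.mem_roots hp0, Polynomial.IsRoot, ← hp',
      ← oscSol_eq_zero_iff, ← hx k]
    exact oscSol_dirichletDeg _ _
  have hcard := Finset.card_le_card_of_injOn (s := Finset.univ) x (fun k _ => hroot k)
    hinj.injOn
  rw [Finset.card_univ, Fintype.card_fin] at hcard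
  have := (Multiset.toFinset_card_le p.roots).trans (p.card_roots')
  omega

/-- For `n < ν < n + 1` and `y` near `-∞`, the limit of the preceding curve puts the angle above `nπ
- π/2` (for `n = 0`, monotonicity does). Were it at most `nπ + π/2`, then `(-1)^n u_ν ≥ 0`, against
the sign in `hermiteR_tendsto_atBot`. So the `n`-th curve lies below `ν`. -/
lemma tendsto_dirichletDeg_atBot (n : ℕ) : Tendsto (dirichletDeg n) atBot (𝓝 n) := by
  induction n using Nat.strong_induction_on with
  | _ n ih =>
    refine tendsto_order.2 ⟨fun a ha => Eventually.of_forall fun y =>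
      ha.trans (lt_dirichletDeg n y), fun a ha => ?_⟩
    -- The cap keeps `ν` inside `(n, n + 1)`, where the sign at `-∞` is known.
    let ν := min a (n + 1 / 2)
    have hν : (n : ℝ) < ν := lt_min ha (by linarith)
    have hν' : ν < n + 1 := (min_le_right _ _).trans_lt (by linarith)
    have hn : (0 : ℝ) ≤ n := n.cast_nonneg
    have hlow : ∀ᶠ y in atBot, n * Real.pi - Real.pi / 2 < oscAngle ν y := by
      rcases Nat.eq_zero_or_pos n with rfl | hpos
      · refine Eventually.of_forall fun y => ?_
        have h1 := (oscAngle_neg_one_mem y).1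
        have h2 : oscAngle (-1) y < oscAngle ν y := strictMono_oscAngle y (by linarith)
        simp only [Nat.cast_zero, zero_mul]
        linarith
      · obtain ⟨m, rfl⟩ := Nat.exists_eq_add_of_lt hpos
        rw [zero_add] at *
        have := (ih m (Nat.lt_succ_self m)).eventually_lt_const
          (show (m : ℝ) < (m + 1 : ℕ) by push_cast; linarith)
        filter_upwards [this] with y hy
        have := (oscLevel_lt_iff (dirichlet_level_nonneg m)).1 (hy.trans hν)
        push_cast
        linarith
    filter_upwards [hlow, (hermiteR_tendsto_atBot n hν hν').eventually_gt_atTop 0] with y h1 h2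
    refine lt_of_lt_of_le ?_ (min_le_left a (n + 1 / 2))
    change dirichletDeg n y < ν
    by_contra! h3
    have h4 : oscAngle ν y ≤ Real.pi / 2 + n * Real.pi := by
      have := (strictMono_oscAngle y).monotone h3
      simpa only [dirichletDeg, oscAngle_oscLevel (dirichlet_level_nonneg n)] using this
    have h5 : 0 ≤ Real.cos (oscAngle ν y - n * Real.pi) :=
      Real.cos_nonneg_of_mem_Icc ⟨by linarith, by linarith⟩
    rw [Real.cos_sub_nat_mul_pi] at h5
    have h6 : 0 ≤ (-1) ^ n * oscSol ν y := by
      rw [(oscSol_polar ν y).1]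
      have := mul_nonneg (Real.sqrt_nonneg (oscSol ν y ^ 2 + oscSolDer ν y ^ 2)) h5
      linarith
    have h7 : 0 < (-1) ^ (n + 1) * oscSol ν y := by
      have := mul_pos (Real.exp_pos (-y ^ 2 / 2)) h2
      unfold oscSol
      linarith
    rw [pow_succ] at h7
    linarith

lemma oscSol_nat_neg (n : ℕ) (y : ℝ) : oscSol n (-y) = (-1) ^ n * oscSol n y := by
  unfold oscSol
  rw [hermiteR_nat_neg, neg_sq]
  ring

lemma oscSolDer_nat_neg (n : ℕ) (y : ℝ) : oscSolDer n (-y) = -((-1) ^ n * oscSolDer n y) := by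
  have h1 : HasDerivAt (fun y => oscSol n (-y)) (-oscSolDer n (-y)) y := by
    have := HasDerivAt.comp (h₂ := oscSol n) y (hasDerivAt_oscSol n (-y)) (hasDerivAt_neg y)
    simpa [Function.comp_def] using this
  have h2 : HasDerivAt (fun y => oscSol n (-y)) ((-1) ^ n * oscSolDer n y) y := by
    have e : (fun y => oscSol n (-y)) = fun y => (-1) ^ n * oscSol n y :=
      funext fun y => oscSol_nat_neg n y
    rw [e]
    exact (hasDerivAt_oscSol n y).const_mul _
  linarith [h1.unique h2]

/-- By parity `u u'` at `y` is the negative of its value at `-y`, a point beyond the turning point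
`√(2n + 1)`, where `u u' < 0`. In polar form `u u'` is half of `sin (2θ)` times the squared radius.
-/
lemma sin_two_mul_oscAngle_pos (n : ℕ) {y : ℝ} (hy : y ≤ -√(2 * n + 1)) :
    0 < Real.sin (2 * oscAngle n y) := by
  have h1 := Real.sqrt_nonneg (2 * (n : ℝ) + 1)
  have h2 := Real.sq_sqrt (show (0 : ℝ) ≤ 2 * n + 1 by positivity)
  have h := oscSol_mul_oscSolDer_neg (ν := n) (y := -y) fun x hx => by nlinarith
  rw [oscSol_nat_neg, oscSolDer_nat_neg] at h
  have h3 : ((-1 : ℝ) ^ n) ^ 2 = 1 := by rw [← pow_mul, mul_comm, pow_mul]; simp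
  have h4 : 0 < oscSol n y * oscSolDer n y := by
    have : (-1 : ℝ) ^ n * oscSol n y * -((-1) ^ n * oscSolDer n y) =
      -(((-1 : ℝ) ^ n) ^ 2 * (oscSol n y * oscSolDer n y)) := by ring
    rw [this, h3] at h
    linarith
  obtain ⟨p1, p2⟩ := oscSol_polar n y
  have e : oscSol n y * oscSolDer n y = √(oscSol n y ^ 2 + oscSolDer n y ^ 2) ^ 2 *
      (Real.sin (oscAngle n y) * Real.cos (oscAngle n y)) := by
    rw [show ∀ S s c : ℝ, S ^ 2 * (s * c) = (S * c) * (S * s) from fun S s c => by ring,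
      ← p1, ← p2]
  rw [e] at h4
  rw [Real.sin_two_mul]
  have hs := Real.sqrt_pos.2 (oscSol_sq_add_pos n y)
  have := pos_of_mul_pos_right h4 (by positivity)
  linarith

/-- Since `sin (2θ) > 0` for `y ≤ -√(2n + 1)`, the angle at degree `n` cannot equal `nπ` there. Near
`-∞` it exceeds `nπ - π/2`, and positivity of `sin (2θ)` pushes it above `nπ`; by continuity it
stays above. -/
lemma neumannDeg_lt (n : ℕ) {y : ℝ} (hy : y ≤ -√(2 * n + 1)) : neumannDeg n y < n := by
  rw [neumannDeg, oscLevel_lt_iff (neumann_level_nonneg n)]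
  have hlow : ∀ᶠ x in atBot, n * Real.pi - Real.pi / 2 < oscAngle n x := by
    rcases Nat.eq_zero_or_pos n with rfl | hpos
    · refine Eventually.of_forall fun x => ?_
      have h1 := (oscAngle_neg_one_mem x).1
      have h2 : oscAngle (-1) x < oscAngle (0 : ℕ) x := strictMono_oscAngle x (by simp)
      simp only [Nat.cast_zero, zero_mul] at h2 ⊢
      linarith
    · obtain ⟨m, rfl⟩ := Nat.exists_eq_add_of_lt hpos
      rw [zero_add] at *
      have := (tendsto_dirichletDeg_atBot m).eventually_lt_const
        (show (m : ℝ) < (m + 1 : ℕ) by push_cast; linarith)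
      filter_upwards [this] with y hy
      have := (oscLevel_lt_iff (dirichlet_level_nonneg m)).1 hy
      push_cast at this ⊢
      linarith
  obtain ⟨x, hx1, hx2⟩ := (hlow.and (eventually_le_atBot y)).exists
  have hx3 : n * Real.pi < oscAngle n x := by
    by_contra! h
    have h1 := sin_two_mul_oscAngle_pos n (hx2.trans hy)
    have h2 : Real.sin (2 * oscAngle n x - n * (2 * Real.pi)) ≤ 0 :=
      Real.sin_nonpos_of_nonpos_of_neg_pi_le (by linarith) (by linarith)
    rw [Real.sin_sub_nat_mul_two_pi] at h2
    linarith
  by_contra! h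
  obtain ⟨z, hz, hz'⟩ := intermediate_value_Icc' hx2 (continuous_oscAngle n).continuousOn
    ⟨h, hx3.le⟩
  have h1 := sin_two_mul_oscAngle_pos n (hz.2.trans hy)
  rw [hz', show 2 * (n * Real.pi) = (2 * n : ℕ) * Real.pi by push_cast; ring,
    Real.sin_nat_mul_pi] at h1
  exact lt_irrefl _ h1

/-! ### Analyticity and monotonicity of the level curves -/

lemma hasStrictFDerivAt_of_continuous_partials {𝕜 : Type*} [RCLike 𝕜] {f fx fy : 𝕜 → 𝕜 → 𝕜}
    (hx : ∀ x y, HasDerivAt (fun x => f x y) (fx x y) x) (hy : ∀ x y, HasDerivAt (f x) (fy x y) y)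
    (cx : Continuous fun p : 𝕜 × 𝕜 => fx p.1 p.2) (cy : Continuous fun p : 𝕜 × 𝕜 => fy p.1 p.2)
    (u : 𝕜 × 𝕜) :
    HasStrictFDerivAt (fun p : 𝕜 × 𝕜 => f p.1 p.2)
      ((ContinuousLinearMap.toSpanSingleton 𝕜 (fx u.1 u.2)).coprod
        (ContinuousLinearMap.toSpanSingleton 𝕜 (fy u.1 u.2))) u := by
  have hspan : Continuous fun c : 𝕜 => ContinuousLinearMap.toSpanSingleton 𝕜 c :=
    (ContinuousLinearMap.toSpanSingletonCLE (𝕜 := 𝕜) (E := 𝕜)).continuous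
  exact hasStrictFDerivAt_uncurry_coprod (𝕜 := 𝕜) (u := u) (f := f)
    (f₁ := fun x y => ContinuousLinearMap.toSpanSingleton 𝕜 (fx x y))
    (f₂ := fun x y => ContinuousLinearMap.toSpanSingleton 𝕜 (fy x y))
    (Eventually.of_forall fun v => (hx v.1 v.2).hasFDerivAt)
    (Eventually.of_forall fun v => (hy v.1 v.2).hasFDerivAt)
    (hspan.comp cx).continuousAt (hspan.comp cy).continuousAt

/-- Chain rule for a function with continuous partial derivatives along a graph. -/
lemma hasDerivAt_graph {f fx fy : ℝ → ℝ → ℝ} {g : ℝ → ℝ} {g' y : ℝ}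
    (hx : ∀ x y, HasDerivAt (fun x => f x y) (fx x y) x) (hy : ∀ x y, HasDerivAt (f x) (fy x y) y)
    (cx : Continuous fun p : ℝ × ℝ => fx p.1 p.2) (cy : Continuous fun p : ℝ × ℝ => fy p.1 p.2)
    (hg : HasDerivAt g g' y) :
    HasDerivAt (fun y => f (g y) y) (g' * fx (g y) y + fy (g y) y) y := by
  have h := (hasStrictFDerivAt_of_continuous_partials hx hy cx cy (g y, y)).hasFDerivAt
  have := h.comp_hasDerivAt (f := fun y => (g y, y)) y (hg.prodMk (hasDerivAt_id y))
  simpa [Function.comp_def] using this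

/-- A continuous real solution of a holomorphic implicit equation is real analytic. -/
lemma analyticAt_of_implicit {f fx fy : ℂ → ℂ → ℂ} {g : ℝ → ℝ} {x : ℝ}
    (hx : ∀ x y, HasDerivAt (fun x => f x y) (fx x y) x) (hy : ∀ x y, HasDerivAt (f x) (fy x y) y)
    (cx : Continuous fun p : ℂ × ℂ => fx p.1 p.2) (cy : Continuous fun p : ℂ × ℂ => fy p.1 p.2)
    (hg : ContinuousAt g x) (h0 : ∀ t : ℝ, f t (g t) = 0) (hne : fy x (g x) ≠ 0) :
    AnalyticAt ℝ g x := by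
  have hs := hasStrictFDerivAt_of_continuous_partials hx hy cx cy
  have hspan : Continuous fun c : ℂ => ContinuousLinearMap.toSpanSingleton ℂ c :=
    (ContinuousLinearMap.toSpanSingletonCLE (𝕜 := ℂ) (E := ℂ)).continuous
  have hC : ContDiff ℂ 1 (fun p : ℂ × ℂ => f p.1 p.2) := by
    rw [contDiff_one_iff_hasFDerivAt]
    refine ⟨_, ?_, fun u => (hs u).hasFDerivAt⟩
    exact (ContinuousLinearMap.coprodEquivL (𝕜 := ℂ) (E := ℂ) (F := ℂ) (G := ℂ) (S := ℂ)).continuous.comp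
      ((hspan.comp cx).prodMk (hspan.comp cy))
  have hinv : (fderiv ℂ (fun p : ℂ × ℂ => f p.1 p.2) ((x : ℂ), (g x : ℂ)) ∘L
      .inr ℂ ℂ ℂ).IsInvertible := by
    rw [(hs _).hasFDerivAt.fderiv, ContinuousLinearMap.coprod_comp_inr]
    refine ⟨ContinuousLinearEquiv.unitsEquivAut ℂ (Units.mk0 _ hne), ?_⟩
    ext
    simp
  have hCa := hC.contDiffAt (x := ((x : ℂ), (g x : ℂ)))
  let φ := hCa.implicitFunction one_ne_zero hinv
  have hφ : ContDiffAt ℂ 1 φ x := hCa.contDiffAt_implicitFunction one_ne_zero hinv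
  -- A complex `C¹` implicit function is differentiable near the point, hence holomorphic.
  have hφa : AnalyticAt ℂ φ x := by
    rw [Complex.analyticAt_iff_eventually_differentiableAt]
    filter_upwards [hφ.eventually (by simp)] with z hz
    exact hz.differentiableAt one_ne_zero
  have hev := hCa.eventually_apply_eq_iff_implicitFunction one_ne_zero hinv
  have ht : Tendsto (fun t : ℝ => ((t : ℂ), (g t : ℂ))) (𝓝 x) (𝓝 ((x : ℂ), (g x : ℂ))) :=
    (Complex.continuous_ofReal.tendsto x).prodMk_nhds
      ((Complex.continuous_ofReal.tendsto (g x)).comp hg)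
  -- Continuity of `g` keeps its graph in the neighbourhood where the implicit function is the only
  -- solution.
  have heq : (fun t : ℝ => (φ t).re) =ᶠ[𝓝 x] g := by
    filter_upwards [ht.eventually hev] with t ht
    have := ht.1 (by simp only [h0])
    simp only [φ, this, Complex.ofReal_re]
  refine AnalyticAt.congr ?_ heq
  have h1 : AnalyticAt ℝ φ (Complex.ofRealCLM x) := hφa.restrictScalars
  exact (Complex.reCLM.analyticAt _).comp (h1.comp (Complex.ofRealCLM.analyticAt x))

@[fun_prop]
lemma continuous_hermiteC_comp {X : Type*} [TopologicalSpace X] {f g : X → ℂ} (hf : Continuous f)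
    (hg : Continuous g) : Continuous fun x => hermiteC (f x) (g x) :=
  Continuous.comp (g := fun p : ℂ × ℂ => hermiteC p.1 p.2) (f := fun x => (f x, g x))
    continuous_hermiteC (hf.prodMk hg)

@[fun_prop]
lemma continuous_hermiteCDeg_comp {X : Type*} [TopologicalSpace X] {f g : X → ℂ}
    (hf : Continuous f) (hg : Continuous g) : Continuous fun x => hermiteCDeg (f x) (g x) :=
  Continuous.comp (g := fun p : ℂ × ℂ => hermiteCDeg p.1 p.2) (f := fun x => (f x, g x))
    continuous_hermiteCDeg (hf.prodMk hg)

/-- On the zero curve the Wronskian keeps a single product. Its sign shows that the degree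
derivative is nonzero, as the implicit function theorem needs, and determines the slope of the
curve. -/
lemma dirichletDeg_wronskian (n : ℕ) (y : ℝ) :
    oscSolDer (dirichletDeg n y) y * oscSolDeg (dirichletDeg n y) y < 0 := by
  have := oscWronskian_pos (dirichletDeg n y) y
  rw [oscWronskian, oscSol_dirichletDeg] at this
  linarith

lemma neumannDeg_wronskian (n : ℕ) (y : ℝ) :
    0 < oscSol (neumannDeg n y) y * oscSolDerDeg (neumannDeg n y) y := by
  have := oscWronskian_pos (neumannDeg n y) y
  rw [oscWronskian, oscSolDer_neumannDeg] at this
  linarith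

lemma analyticAt_dirichletDeg (n : ℕ) (y : ℝ) : AnalyticAt ℝ (dirichletDeg n) y := by
  refine analyticAt_of_implicit (f := fun y ν => hermiteC ν y)
    (fx := fun y ν => 2 * ν * hermiteC (ν - 1) y) (fy := fun y ν => hermiteCDeg ν y)
    (fun y ν => hasDerivAt_hermiteC ν y) (fun y ν => hasDerivAt_hermiteC_degree ν y)
    (by fun_prop) (by fun_prop) (continuous_dirichletDeg n).continuousAt (fun y => ?_) ?_
  · rw [hermiteC_ofReal, Complex.ofReal_eq_zero, ← oscSol_eq_zero_iff]
    exact oscSol_dirichletDeg n y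
  · rw [hermiteCDeg_ofReal, Complex.ofReal_ne_zero]
    intro h
    have := dirichletDeg_wronskian n y
    rw [oscSolDeg, h] at this
    simp at this

lemma analyticAt_neumannDeg (n : ℕ) (y : ℝ) : AnalyticAt ℝ (neumannDeg n) y := by
  refine analyticAt_of_implicit
    (f := fun y ν => 2 * ν * hermiteC (ν - 1) y - y * hermiteC ν y)
    (fx := fun y ν => 2 * ν * (2 * (ν - 1) * hermiteC (ν - 1 - 1) y)
      - (1 * hermiteC ν y + y * (2 * ν * hermiteC (ν - 1) y)))
    (fy := fun y ν => 2 * hermiteC (ν - 1) y + 2 * ν * hermiteCDeg (ν - 1) y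
      - y * hermiteCDeg ν y)
    (fun y ν => ?_) (fun y ν => ?_)
    (by fun_prop) (by fun_prop) (continuous_neumannDeg n).continuousAt (fun y => ?_) ?_
  · exact ((hasDerivAt_hermiteC (ν - 1) y).const_mul (2 * ν)).fun_sub
      ((hasDerivAt_id' y).fun_mul (hasDerivAt_hermiteC ν y))
  · have h1 := (hasDerivAt_hermiteC_degree (ν - 1) y).comp_sub_const ν 1
    have h3 : HasDerivAt (fun ν : ℂ => 2 * ν) 2 ν := by
      simpa using (hasDerivAt_id' ν).const_mul 2
    exact (h3.fun_mul h1).fun_sub ((hasDerivAt_hermiteC_degree ν y).const_mul y)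
  · have h := oscSolDer_neumannDeg n y
    rw [oscSolDer, mul_eq_zero, or_iff_right (Real.exp_ne_zero _)] at h
    have e : ((neumannDeg n y : ℝ) : ℂ) - 1 = ((neumannDeg n y - 1 : ℝ) : ℂ) := by push_cast; rfl
    simp only [e, hermiteC_ofReal]
    exact_mod_cast h
  · have e : ((neumannDeg n y : ℝ) : ℂ) - 1 = ((neumannDeg n y - 1 : ℝ) : ℂ) := by push_cast; rfl
    simp only [e, hermiteC_ofReal, hermiteCDeg_ofReal]
    intro h
    have := neumannDeg_wronskian n y
    rw [oscSolDerDeg, show 2 * hermiteR (neumannDeg n y - 1) y +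
      2 * neumannDeg n y * hermiteRDeg (neumannDeg n y - 1) y
      - y * hermiteRDeg (neumannDeg n y) y = 0 by exact_mod_cast h] at this
    simp at this

/-- Implicit differentiation gives `d ∂_ν u + u' = 0` for the slope `d`, while `u' ∂_ν u < 0` by the
Wronskian. -/
lemma strictMono_dirichletDeg_point (n : ℕ) : StrictMono (dirichletDeg n) := by
  refine strictMono_of_deriv_pos fun y => ?_
  have hd := (analyticAt_dirichletDeg n y).differentiableAt.hasDerivAt
  have h := hasDerivAt_graph (f := oscSol) hasDerivAt_oscSol_degree hasDerivAt_oscSol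
    (by fun_prop) (by fun_prop) hd
  have e : (fun y => oscSol (dirichletDeg n y) y) = fun _ => 0 :=
    funext fun y => oscSol_dirichletDeg n y
  rw [e] at h
  have h0 := h.unique (hasDerivAt_const y 0)
  have hw := dirichletDeg_wronskian n y
  generalize deriv (dirichletDeg n) y = d at *
  generalize oscSolDer (dirichletDeg n y) y = a at *
  generalize oscSolDeg (dirichletDeg n y) y = b at *
  obtain rfl : a = -(d * b) := by linarith
  have : 0 < d * b ^ 2 := by linarith
  exact pos_of_mul_pos_left this (sq_nonneg b)

/-- Implicit differentiation gives `d ∂_ν u' = (2ν + 1 - y²) u` with `u ∂_ν u' > 0`. The slope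
therefore has the sign of `2ν + 1 - y²`, which `neumannDeg_bound` controls only for `0 ≤ y`. -/
lemma strictMonoOn_neumannDeg_point (n : ℕ) : StrictMonoOn (neumannDeg n) (Ici 0) := by
  refine strictMonoOn_of_deriv_pos (convex_Ici 0) (continuous_neumannDeg n).continuousOn
    fun y hy => ?_
  rw [interior_Ici] at hy
  have hd := (analyticAt_neumannDeg n y).differentiableAt.hasDerivAt
  have h := hasDerivAt_graph (f := oscSolDer) hasDerivAt_oscSolDer_degree hasDerivAt_oscSolDer
    (by fun_prop) (by fun_prop) hd
  have e : (fun y => oscSolDer (neumannDeg n y) y) = fun _ => 0 :=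
    funext fun y => oscSolDer_neumannDeg n y
  rw [e] at h
  have h0 := h.unique (hasDerivAt_const y 0)
  have hw := neumannDeg_wronskian n y
  have hb := neumannDeg_bound n (le_of_lt hy)
  generalize deriv (neumannDeg n) y = d at *
  generalize oscSol (neumannDeg n y) y = a at *
  generalize oscSolDerDeg (neumannDeg n y) y = b at *
  have ha : a ≠ 0 := by rintro rfl; simp at hw
  have h1 : d * (a * b) = (2 * neumannDeg n y + 1 - y ^ 2) * a ^ 2 := by
    linear_combination a * h0
  have h2 : 0 < d * (a * b) := by
    rw [h1]
    exact mul_pos (by linarith) (by positivity)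
  exact pos_of_mul_pos_left h2 hw.le

/-! ### Square-integrable eigenfunctions are the decaying solutions -/

lemma eq_of_hasDerivAt_zero_Iic {w : ℝ → ℝ} (hc : Continuous w)
    (hd : ∀ x < 0, HasDerivAt w 0 x) {x : ℝ} (hx : x ≤ 0) : w x = w 0 := by
  have hdiff : DifferentiableOn ℝ w (interior (Iic 0)) := fun x hx => by
    rw [interior_Iic] at hx
    exact (hd x hx).differentiableAt.differentiableWithinAt
  have hz : ∀ x ∈ interior (Iic (0 : ℝ)), deriv w x = 0 := fun x hx => by
    rw [interior_Iic] at hx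
    exact (hd x hx).deriv
  refine le_antisymm ?_ ?_
  · exact monotoneOn_of_deriv_nonneg (convex_Iic 0) hc.continuousOn hdiff
      (fun x hx => (hz x hx).ge) hx (mem_Iic.2 le_rfl) hx
  · exact antitoneOn_of_deriv_nonpos (convex_Iic 0) hc.continuousOn hdiff
      (fun x hx => (hz x hx).le) hx (mem_Iic.2 le_rfl) hx

lemma monotoneOn_Iic_of_hasDerivAt_nonneg {F F' : ℝ → ℝ} {X : ℝ}
    (hc : Continuous F) (hd : ∀ x < X, HasDerivAt F (F' x) x)
    (h : ∀ x < X, 0 ≤ F' x) : MonotoneOn F (Iic X) := by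
  refine monotoneOn_of_deriv_nonneg (convex_Iic X) hc.continuousOn (fun x hx => ?_)
    fun x hx => ?_
  all_goals rw [interior_Iic] at hx
  · exact (hd x hx).differentiableAt.differentiableWithinAt
  · rw [(hd x hx).deriv]
    exact h x hx

/-- A square-integrable solution of `u'' = ((x + η)² - μ) u` is bounded near `-∞`, together with
its derivative. -/
lemma bounded_of_integrable_sq {U V : ℝ → ℝ} {η μ : ℝ} (hV : Continuous V)
    (hU' : ∀ x, HasDerivAt U (V x) x)
    (hV' : ∀ x < 0, HasDerivAt V (((x + η) ^ 2 - μ) * U x) x)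
    (hint : IntegrableOn (fun x => U x ^ 2) (Iio 0)) :
    ∃ C X : ℝ, ∀ x ≤ X, |U x| ≤ C ∧ |V x| ≤ C := by
  have hU : Continuous U := continuous_iff_continuousAt.2 fun x => (hU' x).continuousAt
  -- To the left of `X` the potential `(x + η)²` is at least `μ`.
  let X : ℝ := -(|η| + |μ| + 1)
  have hX : X < 0 := by
    have := abs_nonneg η
    have := abs_nonneg μ
    simp only [X]
    linarith
  have hq : ∀ x < X, 0 ≤ (x + η) ^ 2 - μ := fun x hx => by
    have h1 := le_abs_self η
    have h2 := le_abs_self μ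
    have h3 := abs_nonneg μ
    simp only [X] at hx
    nlinarith
  have hP : MonotoneOn (fun x => U x * V x) (Iic X) := by
    refine monotoneOn_Iic_of_hasDerivAt_nonneg (hU.mul hV)
      (fun x hx => (hU' x).fun_mul (hV' x (hx.trans hX))) fun x hx => ?_
    have := mul_nonneg (hq x hx) (sq_nonneg (U x))
    nlinarith [sq_nonneg (V x)]
  -- If `U V` were negative at `x`, by monotonicity it would stay at most that value further left,
  -- so `U²`, with derivative `2 U V`, would tend to `+∞` at `-∞`, contradicting integrability.
  have hP0 : ∀ x ≤ X, 0 ≤ U x * V x := by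
    by_contra! hneg
    obtain ⟨x, hx, hneg⟩ := hneg
    have ht : Tendsto (fun x => U x ^ 2) atBot atTop := by
      refine tendsto_atBot_atTop_of_deriv_le_neg (F' := fun x => 2 * (U x * V x))
        (c := -(2 * (U x * V x))) (Y := x) (by linarith) (fun z => ?_) fun z hz => ?_
      · refine ((hU' z).fun_pow 2).congr_deriv ?_
        simp only [Nat.cast_ofNat, Nat.add_one_sub_one, pow_one]
        ring
      · have := hP (mem_Iic.2 (hz.trans hx)) (mem_Iic.2 hx) hz
        simp only at this
        linarith
    obtain ⟨Z, hZ⟩ := eventually_atBot.1 (ht.eventually_ge_atTop 1)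
    have h1 : IntegrableOn (fun _ : ℝ => (1 : ℝ)) (Iic (min Z (-1))) := by
      refine Integrable.mono' (hint.mono_set fun z hz => ?_)
        aestronglyMeasurable_const ?_
      · have := (mem_Iic.1 hz).trans (min_le_right _ _)
        exact mem_Iio.2 (by linarith)
      · refine (ae_restrict_iff' measurableSet_Iic).2 (Eventually.of_forall fun z hz => ?_)
        simpa using hZ z ((mem_Iic.1 hz).trans (min_le_left _ _))
    rw [integrableOn_const_iff] at h1
    simp at h1
  have hU2 : MonotoneOn (fun x => U x ^ 2) (Iic X) := by
    refine monotoneOn_Iic_of_hasDerivAt_nonneg (hU.pow 2)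
      (fun x _ => (hU' x).fun_pow 2) fun x hx => ?_
    simp only [Nat.cast_ofNat, Nat.add_one_sub_one, pow_one]
    linarith [hP0 x hx.le]
  have hV2 : MonotoneOn (fun x => V x ^ 2) (Iic X) := by
    refine monotoneOn_Iic_of_hasDerivAt_nonneg (hV.pow 2)
      (fun x hx => (hV' x (hx.trans hX)).fun_pow 2) fun x hx => ?_
    simp only [Nat.cast_ofNat, Nat.add_one_sub_one, pow_one]
    have := mul_nonneg (hq x hx) (hP0 x hx.le)
    linarith
  refine ⟨|U X| + |V X|, X, fun x hx => ⟨?_, ?_⟩⟩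
  · have := sq_le_sq.1 (hU2 (mem_Iic.2 hx) (mem_Iic.2 le_rfl) hx)
    linarith [abs_nonneg (V X)]
  · have := sq_le_sq.1 (hV2 (mem_Iic.2 hx) (mem_Iic.2 le_rfl) hx)
    linarith [abs_nonneg (U X)]

lemma hasDerivAt_oscSol_reflect (ν η x : ℝ) :
    HasDerivAt (fun x => oscSol ν (-η - x)) (-oscSolDer ν (-η - x)) x := by
  have := HasDerivAt.comp (h₂ := oscSol ν) x (hasDerivAt_oscSol ν (-η - x))
    ((hasDerivAt_id' x).const_sub (-η))
  simpa [Function.comp_def] using this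

lemma hasDerivAt_oscSolDer_reflect (ν η x : ℝ) :
    HasDerivAt (fun x => -oscSolDer ν (-η - x))
      (((x + η) ^ 2 - (2 * ν + 1)) * oscSol ν (-η - x)) x := by
  have := (HasDerivAt.comp (h₂ := oscSolDer ν) x (hasDerivAt_oscSolDer ν (-η - x))
    ((hasDerivAt_id' x).const_sub (-η))).fun_neg
  refine this.congr_deriv ?_
  ring

/-- The Wronskian of `U` with the reflected decaying solution is constant, and it tends to `0` at
`-∞` because `U` and `V` are bounded while the decaying solution and its derivative vanish in the
limit. Zero Wronskian means proportionality. -/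
lemma eq_const_mul_oscSol {U V : ℝ → ℝ} {η ν : ℝ} (hV : Continuous V)
    (hU' : ∀ x, HasDerivAt U (V x) x)
    (hV' : ∀ x < 0, HasDerivAt V (((x + η) ^ 2 - (2 * ν + 1)) * U x) x)
    (hint : IntegrableOn (fun x => U x ^ 2) (Iio 0)) :
    ∃ k : ℝ, ∀ x ≤ 0, U x = k * oscSol ν (-η - x) ∧ V x = k * -oscSolDer ν (-η - x) := by
  have hU : Continuous U := continuous_iff_continuousAt.2 fun x => (hU' x).continuousAt
  obtain ⟨C, X, hb⟩ := bounded_of_integrable_sq hV hU' hV' hint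
  let S : ℝ → ℝ := fun x => oscSol ν (-η - x)
  let T : ℝ → ℝ := fun x => -oscSolDer ν (-η - x)
  have hS : Continuous S := by simp only [S]; fun_prop
  have hT : Continuous T := by simp only [T]; fun_prop
  have hS' : ∀ x, HasDerivAt S (T x) x := hasDerivAt_oscSol_reflect ν η
  have hT' : ∀ x, HasDerivAt T (((x + η) ^ 2 - (2 * ν + 1)) * S x) x :=
    hasDerivAt_oscSolDer_reflect ν η
  have hr : Tendsto (fun x : ℝ => -η - x) atBot atTop :=
    tendsto_atTop_add_const_left _ _ tendsto_neg_atBot_atTop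
  have hS0 : Tendsto S atBot (𝓝 0) := (oscSol_tendsto ν).comp hr
  have hT0 : Tendsto T atBot (𝓝 0) := by
    simpa using ((oscSolDer_tendsto ν).comp hr).neg
  have hST : ∀ x, 0 < S x ^ 2 + T x ^ 2 := fun x => by
    simpa only [S, T, neg_sq] using oscSol_sq_add_pos ν (-η - x)
  have hw : ∀ x ≤ 0, U x * T x - V x * S x = 0 := by
    have hc : ∀ x ≤ 0, U x * T x - V x * S x = U 0 * T 0 - V 0 * S 0 := fun x hx => by
      refine eq_of_hasDerivAt_zero_Iic (w := fun x => U x * T x - V x * S x)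
        ((hU.mul hT).sub (hV.mul hS)) (fun z hz => ?_) hx
      refine (((hU' z).fun_mul (hT' z)).fun_sub ((hV' z hz).fun_mul (hS' z))).congr_deriv ?_
      ring
    have hbd : ∀ F : ℝ → ℝ, (∀ x ≤ X, |F x| ≤ C) → IsBoundedUnder (· ≤ ·) atBot
        (norm ∘ F) := fun F hF => isBoundedUnder_of_eventually_le (a := C) (by
      filter_upwards [eventually_le_atBot X] with x hx using hF x hx)
    have h1 : Tendsto (fun x => U x * T x - V x * S x) atBot (𝓝 0) := by
      have h2 := hT0.zero_mul_isBoundedUnder_le (hbd U fun x hx => (hb x hx).1)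
      have h3 := hS0.zero_mul_isBoundedUnder_le (hbd V fun x hx => (hb x hx).2)
      simpa [mul_comm] using h2.sub h3
    have h4 : Tendsto (fun x => U x * T x - V x * S x) atBot (𝓝 (U 0 * T 0 - V 0 * S 0)) := by
      refine tendsto_const_nhds.congr' ?_
      filter_upwards [eventually_le_atBot 0] with x hx using (hc x hx).symm
    have h5 := tendsto_nhds_unique h4 h1
    intro x hx
    rw [hc x hx, h5]
  -- The coefficient of the projection of `(U, V)` on `(S, T)`: unlike `U / S`, it is defined at the
  -- zeros of `S`.
  let k : ℝ → ℝ := fun x => (U x * S x + V x * T x) / (S x ^ 2 + T x ^ 2)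
  have hk1 : ∀ x ≤ 0, U x = k x * S x := fun x hx => by
    have := hST x
    have := hw x hx
    simp only [k]
    field_simp
    linear_combination T x * this
  have hk2 : ∀ x ≤ 0, V x = k x * T x := fun x hx => by
    have := hST x
    have := hw x hx
    simp only [k]
    field_simp
    linear_combination -S x * this
  have hk : ∀ x ≤ 0, k x = k 0 := fun x hx => by
    refine eq_of_hasDerivAt_zero_Iic ?_ (fun z hz => ?_) hx
    · exact ((hU.mul hS).add (hV.mul hT)).div ((hS.pow 2).add (hT.pow 2)) fun x => (hST x).ne'
    · have h1 := ((((hU' z).fun_mul (hS' z)).fun_add ((hV' z hz).fun_mul (hT' z))).fun_div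
        (((hS' z).fun_pow 2).fun_add ((hT' z).fun_pow 2)) (hST z).ne')
      refine h1.congr_deriv ?_
      rw [div_eq_zero_iff]
      left
      rw [hk1 z hz.le, hk2 z hz.le]
      simp only [Nat.cast_ofNat, Nat.add_one_sub_one, pow_one]
      ring
  refine ⟨k 0, fun x hx => ⟨?_, ?_⟩⟩
  · rw [hk1 x hx, hk x hx]
  · rw [hk2 x hx, hk x hx]

lemma integral_oscillator_congr {η μ : ℝ} {f : L2NegHalfLine} {u : ℝ → ℝ}
    (hf : f =ᵐ[volume.restrict (Iio (0 : ℝ))] u) {x : ℝ} (hx : x ≤ 0) :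
    ∫ t in x..0, ((t + η) ^ 2 * u t - (μ • f : L2NegHalfLine) t) =
      ∫ t in x..0, ((t + η) ^ 2 - μ) * u t := by
  refine intervalIntegral.integral_congr_ae ?_
  have h := hf.and (Lp.coeFn_smul μ f)
  rw [ae_restrict_iff' measurableSet_Iio] at h
  have h0 : ∀ᵐ t : ℝ, t ≠ 0 := by simp [ae_iff, measure_singleton]
  filter_upwards [h, h0] with t ht ht0 hmem
  rw [uIoc_of_le hx] at hmem
  obtain ⟨h1, h2⟩ := ht (lt_of_le_of_ne hmem.2 ht0)
  rw [h2, Pi.smul_apply, h1, smul_eq_mul]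
  ring

/-- The representative of an eigenfunction, as a classical solution. -/
lemma IsOscillatorGraph.exists_solution {bc : BoundaryCondition} {η μ : ℝ} {f : L2NegHalfLine}
    (h : IsOscillatorGraph bc η f (μ • f)) :
    ∃ U V : ℝ → ℝ, Continuous V ∧ (∀ x, HasDerivAt U (V x) x) ∧
      (∀ x < 0, HasDerivAt V (((x + η) ^ 2 - μ) * U x) x) ∧
      f =ᵐ[volume.restrict (Iio (0 : ℝ))] U ∧ bc.Holds (U 0) (V 0) := by
  obtain ⟨u, v, hf, hu, hv, hbc⟩ := h
  -- Nothing is known about `u` and `v` to the right of `0`; cutting `u` off and redefining both as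
  -- primitives makes `V` continuous and `U` differentiable on the whole line, without changing them
  -- for `x ≤ 0`.
  let u₁ : ℝ → ℝ := (Iio (0 : ℝ)).indicator u
  have hu₁ : MemLp u₁ 2 volume := by
    rw [memLp_indicator_iff_restrict measurableSet_Iio]
    exact (memLp_congr_ae hf).1 (Lp.memLp f)
  let q : ℝ → ℝ := fun t => (t + η) ^ 2 - μ
  have hq : Continuous q := by simp only [q]; fun_prop
  have hqi : ∀ a b, IntervalIntegrable (fun t => q t * u₁ t) volume a b := fun a b =>
    
    (((hu₁.locallyIntegrable (by norm_num)).integrableOn_isCompact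
      isCompact_uIcc).intervalIntegrable (a := a) (b := b)).continuousOn_mul hq.continuousOn
  let V : ℝ → ℝ := fun x => v 0 - ∫ t in x..0, q t * u₁ t
  have hVc : Continuous V := by
    have := intervalIntegral.continuous_primitive hqi 0
    have e : V = fun x => v 0 + ∫ t in (0 : ℝ)..x, q t * u₁ t := by
      funext x
      simp only [V]
      rw [intervalIntegral.integral_symm]
      ring
    rw [e]
    exact continuous_const.add this
  have hVv : ∀ x ≤ 0, V x = v x := fun x hx => by
    rw [hv x hx, integral_oscillator_congr hf hx]
    simp only [V]
    congr 1
    refine intervalIntegral.integral_congr_ae ?_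
    have h0 : ∀ᵐ t : ℝ, t ≠ 0 := by simp [ae_iff, measure_singleton]
    filter_upwards [h0] with t ht hmem
    rw [uIoc_of_le hx] at hmem
    have : t ∈ Iio (0 : ℝ) := lt_of_le_of_ne hmem.2 ht
    simp only [u₁, q, indicator_of_mem this]
  let U : ℝ → ℝ := fun x => u 0 - ∫ t in x..0, V t
  have hU' : ∀ x, HasDerivAt U (V x) x := fun x => by
    have := (intervalIntegral.integral_hasDerivAt_left (hVc.intervalIntegrable x 0)
      (hVc.stronglyMeasurableAtFilter _ _) hVc.continuousAt).const_sub (u 0)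
    simpa using this
  have hUu : ∀ x ≤ 0, U x = u x := fun x hx => by
    rw [hu x hx]
    simp only [U]
    congr 1
    refine intervalIntegral.integral_congr fun t ht => ?_
    rw [uIcc_of_le hx] at ht
    exact hVv t ht.2
  refine ⟨U, V, hVc, hU', fun x hx => ?_, hf.trans ?_, ?_⟩
  · have hUc : ContinuousAt (fun t => q t * U t) x := hq.continuousAt.mul (hU' x).continuousAt
    have heq : (fun t => q t * u₁ t) =ᶠ[𝓝 x] fun t => q t * U t := by
      filter_upwards [Iio_mem_nhds hx] with t ht
      simp only [u₁, indicator_of_mem ht, hUu t (le_of_lt ht)]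
    have hc : ContinuousAt (fun t => q t * u₁ t) x := hUc.congr heq.symm
    have hm : StronglyMeasurableAtFilter (fun t => q t * u₁ t) (𝓝 x) volume :=
      AEStronglyMeasurable.stronglyMeasurableAtFilter
        (hq.aestronglyMeasurable.mul hu₁.aestronglyMeasurable)
    have := (intervalIntegral.integral_hasDerivAt_left (hqi x 0) hm hc).const_sub (v 0)
    rw [neg_neg] at this
    exact this.congr_deriv heq.self_of_nhds
  · refine (ae_restrict_iff' measurableSet_Iio).2 (Eventually.of_forall fun x hx => ?_)
    exact (hUu x (le_of_lt hx)).symm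
  · rwa [hUu 0 le_rfl, hVv 0 le_rfl]

lemma BoundaryCondition.holds_mul_iff (bc : BoundaryCondition) {k a b : ℝ} (hk : k ≠ 0) :
    bc.Holds (k * a) (k * -b) ↔ bc.Holds a b := by
  cases bc <;> simp [BoundaryCondition.Holds, hk]

lemma IsOscillatorEigenfunction.eq_const_mul {bc : BoundaryCondition} {η ν : ℝ}
    {f : L2NegHalfLine} (h : IsOscillatorEigenfunction bc η (2 * ν + 1) f) :
    ∃ k : ℝ, k ≠ 0 ∧ f =ᵐ[volume.restrict (Iio (0 : ℝ))] (fun x => k * oscSol ν (-η - x)) ∧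
      bc.Holds (oscSol ν (-η)) (oscSolDer ν (-η)) := by
  obtain ⟨hf0, hf⟩ := h
  obtain ⟨U, V, hV, hU', hV', hfU, hbc⟩ := hf.exists_solution
  have hint : IntegrableOn (fun x => U x ^ 2) (Iio 0) := by
    have := (memLp_congr_ae hfU).1 (Lp.memLp f)
    exact this.integrable_sq
  obtain ⟨k, hk⟩ := eq_const_mul_oscSol hV hU' hV' hint
  have hfk : f =ᵐ[volume.restrict (Iio (0 : ℝ))] (fun x => k * oscSol ν (-η - x)) := by
    refine hfU.trans ((ae_restrict_iff' measurableSet_Iio).2 (Eventually.of_forall fun x hx => ?_))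
    exact (hk x (le_of_lt hx)).1
  have hk0 : k ≠ 0 := by
    rintro rfl
    refine hf0 (Lp.eq_zero_iff_ae_eq_zero.2 (hfk.trans (Eventually.of_forall fun x => ?_)))
    simp
  refine ⟨k, hk0, hfk, ?_⟩
  obtain ⟨h1, h2⟩ := hk 0 le_rfl
  rw [h1, h2, sub_zero, bc.holds_mul_iff hk0] at hbc
  exact hbc

/-! ### Eigenvalues as zeros in the degree, and the conclusion -/

lemma memLp_oscSol (ν η : ℝ) :
    MemLp (fun x => oscSol ν (-η - x)) 2 (volume.restrict (Iio (0 : ℝ))) := by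
  have hc : Continuous fun x => oscSol ν (-η - x) := by fun_prop
  rw [memLp_two_iff_integrable_sq hc.aestronglyMeasurable]
  have h1 : IntegrableOn (fun y => oscSol ν y ^ 2) (Ioi (-η)) := by
    refine integrable_of_isBigO_exp_neg (b := 1) one_pos
      (by fun_prop : Continuous fun y => oscSol ν y ^ 2).continuousOn ?_
    have := (oscSol_isBigO ν).mul ((oscSol_tendsto ν).isBigO_one ℝ)
    simpa [sq] using this
  have h2 := ((Measure.measurePreserving_sub_left volume (-η)).integrableOn_comp_preimage
    (MeasurableEquiv.subLeft (-η)).measurableEmbedding).2 h1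
  have e : (fun x => -η - x) ⁻¹' Ioi (-η) = Iio 0 := by
    ext x
    simp
  rw [e] at h2
  exact h2

lemma exists_eigenfunction {bc : BoundaryCondition} {η ν : ℝ}
    (h : bc.Holds (oscSol ν (-η)) (oscSolDer ν (-η))) :
    ∃ f, IsOscillatorEigenfunction bc η (2 * ν + 1) f := by
  have hS : Continuous fun x => oscSol ν (-η - x) := by fun_prop
  have hT : Continuous fun x => -oscSolDer ν (-η - x) := by fun_prop
  have hcoe := (memLp_oscSol ν η).coeFn_toLp
  refine ⟨(memLp_oscSol ν η).toLp _, fun h0 => ?_, fun x => oscSol ν (-η - x),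
    fun x => -oscSolDer ν (-η - x), hcoe, fun x hx => ?_, fun x hx => ?_, ?_⟩
  · have h1 := hcoe.symm.trans (Lp.eq_zero_iff_ae_eq_zero.1 h0)
    have h2 := Measure.eqOn_open_of_ae_eq h1 isOpen_Iio hS.continuousOn continuousOn_const
    obtain ⟨z, hz, hz'⟩ := exists_oscSol_ne_zero ν (-η)
    refine hz' ?_
    have := h2 (mem_Iio.2 (by linarith : -η - z < 0))
    simpa using this
  · rw [intervalIntegral.integral_eq_sub_of_hasDerivAt
      (fun t _ => hasDerivAt_oscSol_reflect ν η t) (hT.intervalIntegrable _ _)]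
    ring
  · rw [integral_oscillator_congr hcoe hx, intervalIntegral.integral_eq_sub_of_hasDerivAt
      (fun t _ => hasDerivAt_oscSolDer_reflect ν η t)
      ((by fun_prop : Continuous fun t => ((t + η) ^ 2 - (2 * ν + 1)) *
        oscSol ν (-η - t)).intervalIntegrable _ _)]
    ring
  · have := (bc.holds_mul_iff one_ne_zero).2 h
    simpa using this

lemma mem_oscillatorEigenvalues_iff {bc : BoundaryCondition} {η ν : ℝ} :
    2 * ν + 1 ∈ oscillatorEigenvalues bc η ↔ bc.Holds (oscSol ν (-η)) (oscSolDer ν (-η)) := by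
  refine ⟨?_, exists_eigenfunction⟩
  rintro ⟨f, hf⟩
  obtain ⟨k, -, -, h⟩ := hf.eq_const_mul
  exact h

lemma IsOscillatorEigenfunction.exists_smul_eq {bc : BoundaryCondition} {η ν : ℝ}
    {f g : L2NegHalfLine} (hf : IsOscillatorEigenfunction bc η (2 * ν + 1) f)
    (hg : IsOscillatorEigenfunction bc η (2 * ν + 1) g) : ∃ c : ℝ, g = c • f := by
  obtain ⟨k, hk, hfk, -⟩ := hf.eq_const_mul
  obtain ⟨l, -, hgl, -⟩ := hg.eq_const_mul
  refine ⟨l / k, Lp.ext ?_⟩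
  filter_upwards [hfk, hgl, Lp.coeFn_smul (l / k) f] with x h1 h2 h3
  rw [h2, h3, Pi.smul_apply, h1, smul_eq_mul]
  field_simp

lemma isOscillatorEigenvalueSequence_of {bc : BoundaryCondition} {η : ℝ} {d : ℕ → ℝ}
    (hd : StrictMono d)
    (h : ∀ ν, bc.Holds (oscSol ν (-η)) (oscSolDer ν (-η)) ↔ ∃ n, d n = ν) :
    IsOscillatorEigenvalueSequence bc η fun n => 2 * d n + 1 where
  strictMono := fun m n hmn => by
    have := hd hmn
    simp only
    linarith
  range_eq := by
    ext μ
    obtain ⟨ν, rfl⟩ : ∃ ν, μ = 2 * ν + 1 := ⟨(μ - 1) / 2, by ring⟩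
    rw [mem_oscillatorEigenvalues_iff, h, mem_range]
    refine exists_congr fun n => ⟨fun h => by linarith, fun h => by rw [h]⟩
  simple := fun n f g hf hg => hf.exists_smul_eq hg

lemma analyticAt_eigenvalue {d : ℝ → ℝ} (hd : ∀ y, AnalyticAt ℝ d y) (η : ℝ) :
    AnalyticAt ℝ (fun η => 2 * d (-η) + 1) η := by
  have h1 : AnalyticAt ℝ (fun η : ℝ => -η) η := analyticAt_id.neg
  exact (analyticAt_const.mul ((hd (-η)).fun_comp h1)).add analyticAt_const

lemma tendsto_eigenvalue_atBot {d : ℝ → ℝ} (h : ∀ y, 0 ≤ y → y ^ 2 < 2 * d y + 1) :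
    Tendsto (fun η => 2 * d (-η) + 1) atBot atTop :=
  (tendsto_atTop_of_sq_lt h).comp tendsto_neg_atBot_atTop

/-- `lamD n η` and `lamN n η` are the Dirichlet and the Neumann eigenvalues of
`-∂ₓ² + (x + η)²` on `x < 0`, in increasing order, `n = 0, 1, 2, …`. -/
theorem proposition15 :
    ∃ lamD lamN : ℕ → ℝ → ℝ,
      (∀ η : ℝ, IsOscillatorEigenvalueSequence .dirichlet η (fun n => lamD n η)) ∧
      (∀ η : ℝ, IsOscillatorEigenvalueSequence .neumann η (fun n => lamN n η)) ∧
      -- real analyticity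
      (∀ n : ℕ, AnalyticOnNhd ℝ (lamD n) univ ∧ AnalyticOnNhd ℝ (lamN n) univ) ∧
      -- (i) the Dirichlet eigenvalues
      (∀ n : ℕ, StrictAnti (lamD n) ∧
        Tendsto (lamD n) atBot atTop ∧
        Tendsto (lamD n) atTop (𝓝 (2 * (n : ℝ) + 1)) ∧
        lamD n 0 = 4 * (n : ℝ) + 3) ∧
      -- (ii) the Neumann eigenvalues
      (∀ n : ℕ, StrictAntiOn (lamN n) (Iic 0) ∧
        Tendsto (lamN n) atBot atTop ∧
        (∀ η : ℝ, Real.sqrt (2 * (n : ℝ) + 1) ≤ η → lamN n η < 2 * (n : ℝ) + 1) ∧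
        lamN n 0 = 4 * (n : ℝ) + 1) ∧
      -- (iii) interlacing and lower bounds
      (∀ (n : ℕ) (η : ℝ), lamN n η < lamD n η ∧ lamD n η < lamN (n + 1) η ∧
        2 * (n : ℝ) + 1 < lamD n η ∧
        max (2 * (n : ℝ) - 1) 0 < lamN n η) := by
  -- The energy is `2ν + 1` and the boundary point is `y = -η`, so growth in `y` becomes decrease in
  -- `η` and the two limits trade places.
  refine ⟨fun n η => 2 * dirichletDeg n (-η) + 1, fun n η => 2 * neumannDeg n (-η) + 1,
    fun η => ?_, fun η => ?_, fun n => ⟨fun η _ => ?_, fun η _ => ?_⟩,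
    fun n => ⟨fun a b hab => ?_, ?_, ?_, ?_⟩, fun n => ⟨fun a ha b hb hab => ?_, ?_, fun η hη => ?_,
    ?_⟩, fun n η => ⟨?_, ?_, ?_, ?_⟩⟩
  · exact isOscillatorEigenvalueSequence_of (strictMono_dirichletDeg (-η))
      fun ν => oscSol_eq_zero_iff_dirichletDeg
  · exact isOscillatorEigenvalueSequence_of (strictMono_neumannDeg (-η))
      fun ν => oscSolDer_eq_zero_iff_neumannDeg
  · exact analyticAt_eigenvalue (analyticAt_dirichletDeg n) η
  · exact analyticAt_eigenvalue (analyticAt_neumannDeg n) η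
  · have := strictMono_dirichletDeg_point n (neg_lt_neg hab)
    simp only
    linarith
  · exact tendsto_eigenvalue_atBot fun y hy => dirichletDeg_bound n hy
  · exact (((tendsto_dirichletDeg_atBot n).comp tendsto_neg_atTop_atBot).const_mul 2).add_const 1
  · simp only [neg_zero, dirichletDeg_zero]
    ring
  · have := strictMonoOn_neumannDeg_point n (mem_Ici.2 (neg_nonneg.2 (mem_Iic.1 hb)))
      (mem_Ici.2 (neg_nonneg.2 (mem_Iic.1 ha))) (neg_lt_neg hab)
    simp only
    linarith
  · exact tendsto_eigenvalue_atBot fun y hy => neumannDeg_bound n hy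
  · have := neumannDeg_lt n (neg_le_neg hη)
    simp only
    linarith
  · simp only [neg_zero, neumannDeg_zero]
    ring
  · have := neumannDeg_lt_dirichletDeg n (-η)
    simp only
    linarith
  · have := dirichletDeg_lt_neumannDeg n (-η)
    simp only
    linarith
  · have := lt_dirichletDeg n (-η)
    simp only
    linarith
  · refine max_lt ?_ (neumannDeg_pos n (-η))
    -- For `n = 0` the bound `-1` follows from positivity; for index `n + 1`, interlacing puts the
    -- Neumann degree above the `n`-th Dirichlet degree, hence above `n`.
    cases n with
    | zero =>
      have := neumannDeg_pos 0 (-η)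
      simp only [Nat.cast_zero]
      linarith
    | succ n =>
      have h1 := lt_dirichletDeg n (-η)
      have h2 := dirichletDeg_lt_neumannDeg n (-η)
      push_cast
      linarith
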